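/- \textbf{Channel.} Fix an integer $M\ge 1$ and, for each $K\ge 1$, consider the $K$-user interference channel of Wyner's asymmetric type (connectivity parameter $L=1$) \[ Y_i(t)=H_{i,i}(t)X_i(t)+H_{i,i-1}(t)X_{i-1}(t)+Z_i(t),\qquad 1\le i\le K \] (the middle term is absent for $i=1$), with complex signals and coefficients, where the $Z_i(t)$ are independent circularly symmetric complex Gaussian random variables of mean $0$ and variance $1$. The coefficients $H_{i,j}(t)$ with $j\in\{i-1,i\}$ are drawn independently from an atomless probability law $\mu$ on $\mathbb C$: either once, and then kept for all time slots $t$ (static channel), or afresh and independently in every time slot (time-varying channel). In the time-varying case assume that $\int \max(0,\log|h|)\,d\mu(h)<\infty$. The channel realization is known to all terminals. \textbf{Codes.} Message $W_i$, intended for receiver $i$, is known exactly to the transmitters in the transmit set $\mathcal T_i\subseteq\{1,\dots,K\}$; the messages are independent and uniformly distributed on finite sets $\mathcal W_i$. In a code of block length $n$ and power $P$, transmitter $j$ sends a function $X_j=(X_j(1),\dots,X_j(n))$ of the messages known to it, with $\sum_{t=1}^n|X_j(t)|^2\le nP$ for all values of the messages, and receiver $i$ estimates $W_i$ from $(Y_i(1),\dots,Y_i(n))$.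 Given a channel realization, nonnegative rates $(R_1,\dots,R_K)$ are achievable with power $P$ if for every $\varepsilon>0$ and all sufficiently large $n$ there is such a code with $\log|\mathcal W_i|\ge nR_i$ and with probability of decoding $W_i$ wrongly at most $\varepsilon$, for all $i$. \textbf{Degrees of freedom.} For given transmit sets, a tuple $(d_1,\dots,d_K)$ is achievable if for almost every channel realization there are, for every $P>0$, rates $R_i(P)$ achievable with power $P$ such that $d_i=\lim_{P\to\infty}R_i(P)/\log P$ for all $i$. The DoF region is the closure of the set of achievable tuples. Let $\eta_1(K,M)$ be the maximum of $\sum_{i=1}^K d_i$ over all choices of transmit sets with $|\mathcal T_i|\le M$ for all $i$ and over all points $(d_1,\dots,d_K)$ of the corresponding DoF region. \textbf{Theorem.} The maximum $\eta_1(K,M)$ exists for every $K$, and the asymptotic per user DoF of Wyner's asymmetric model with cooperation order $M$ is \[ \tau_1(M)=\lim_{K\to\infty}\frac{\eta_1(K,M)}{K}=\frac{2M}{2M+1}\qquad\text{for every integer } M\ge 1 . \] -/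

import Mathlib

open MeasureTheory ProbabilityTheory Filter Topology

namespace CoMP

noncomputable section

/-- The circularly symmetric complex Gaussian law with mean zero and unit variance: the real and
imaginary parts are independent real Gaussians of variance `1 / 2`. -/
def complexGaussian : Measure ℂ :=
  ((gaussianReal 0 (1 / 2)).prod (gaussianReal 0 (1 / 2))).map
    (fun p : ℝ × ℝ => (⟨p.1, p.2⟩ : ℂ))

/-- The joint law of the noise `Z i t`, `i` a receiver and `t` a time slot:
all entries are independent complex Gaussians. -/
def noiseLaw (K n : ℕ) : Measure (Fin K → Fin n → ℂ) :=
  Measure.pi fun _ => Measure.pi fun _ => complexGaussian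

/-- Receiver `i` hears transmitter `j` if and only if `i - ⌈L/2⌉ ≤ j ≤ i + ⌊L/2⌋`. For `L = 1`
(Wyner's asymmetric model) receiver `i` hears transmitters `i` and `i - 1`. -/
def Connected (L : ℕ) {K : ℕ} (i j : Fin K) : Prop :=
  (i : ℕ) ≤ (j : ℕ) + (L + 1) / 2 ∧ (j : ℕ) ≤ (i : ℕ) + L / 2

instance (L : ℕ) {K : ℕ} (i j : Fin K) : Decidable (Connected L i j) := by
  unfold Connected; infer_instance

/-- The two standard kinds of channel variation: the coefficients are drawn once and kept for
all time slots, or they are drawn afresh, independently, in every time slot. -/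
inductive Fading
  | static
  | timeVarying

/-- The index of the draw of channel coefficients that is in force in time slot `t`. -/
def Fading.draw : Fading → ℕ → ℕ
  | .static, _ => 0
  | .timeVarying, t => t

/-- The law of the draws of channel coefficients: all entries are independent with common
law `μ`. -/
def drawLaw (μ : Measure ℂ) (K : ℕ) : Measure (ℕ × Fin K × Fin K → ℂ) :=
  Measure.infinitePi fun _ => μ

/-- The channel coefficient from transmitter `j` to receiver `i` in time slot `t`
for the realization `g` of the draws. -/
def coeff (L : ℕ) (f : Fading) {K : ℕ} (g : ℕ × Fin K × Fin K → ℂ) (t : ℕ) :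
    Matrix (Fin K) (Fin K) ℂ :=
  fun i j => if Connected L i j then g (f.draw t, i, j) else 0

/-- A block code of length `n` for the `K`-user channel. The messages are the elements of
`Fin (size i)`, the transmit set of message `i` is `T i`, and the average transmit power of every
transmitter is at most `P`. -/
structure Code (K n : ℕ) (T : Fin K → Finset (Fin K)) (P : ℝ) where
  /-- the number of messages intended for each receiver -/
  size : Fin K → ℕ
  /-- the signal sent by each transmitter, for each tuple of messages -/
  enc : Fin K → (∀ i, Fin (size i)) → Fin n → ℂ
  /-- the decision of each receiver on its own message, given its received signal -/
  dec : ∀ i, (Fin n → ℂ) → Fin (size i)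
  /-- transmitter `j` knows only the messages `i` with `j ∈ T i` -/
  enc_eq : ∀ j w w', (∀ i, j ∈ T i → w i = w' i) → enc j w = enc j w'
  power_le : ∀ j w, ∑ t, ‖enc j w t‖ ^ 2 ≤ n * P
  measurable_dec : ∀ i, Measurable (dec i)

/-- The received signals `Y i t = ∑ j, H t i j * X j t + Z i t`. -/
def received {K n : ℕ} (H : ℕ → Matrix (Fin K) (Fin K) ℂ) (x z : Fin K → Fin n → ℂ) :
    Fin K → Fin n → ℂ :=
  fun i t => ∑ j, H t i j * x j t + z i t

/-- The probability that receiver `i` decodes its message wrongly, when the messages are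
independent and uniformly distributed. -/
def Code.errorProb {K n : ℕ} {T : Fin K → Finset (Fin K)} {P : ℝ} (c : Code K n T P)
    (H : ℕ → Matrix (Fin K) (Fin K) ℂ) (i : Fin K) : ℝ :=
  (∑ w : (∀ k, Fin (c.size k)),
      (noiseLaw K n).real {z | c.dec i (received H (fun j => c.enc j w) z i) ≠ w i}) /
    ∏ k, (c.size k : ℝ)

/-- The rate tuple `R` (in nats per time slot) is achievable with power `P` on the channel `H`:
for all large block lengths there are codes of at least these rates, with all error
probabilities simultaneously as small as desired. -/
def RateAchievable {K : ℕ} (T : Fin K → Finset (Fin K)) (H : ℕ → Matrix (Fin K) (Fin K) ℂ)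
    (P : ℝ) (R : Fin K → ℝ) : Prop :=
  (∀ i, 0 ≤ R i) ∧
    ∀ ε : ℝ, 0 < ε → ∃ N : ℕ, ∀ n ≥ N, ∃ c : Code K n T P,
      (∀ i, Real.exp (n * R i) ≤ c.size i) ∧ ∀ i, c.errorProb H i ≤ ε

/-- The tuple `d` of degrees of freedom is achievable on the channel `H`: `d i` is the limit of
`R i P / log P` as `P → ∞`, for rates that are achievable at every power `P`. -/
def DoFAchievable {K : ℕ} (T : Fin K → Finset (Fin K)) (H : ℕ → Matrix (Fin K) (Fin K) ℂ)
    (d : Fin K → ℝ) : Prop :=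
  ∃ R : ℝ → Fin K → ℝ, (∀ P, 0 < P → RateAchievable T H P (R P)) ∧
    ∀ i, Tendsto (fun P => R P i / Real.log P) atTop (𝓝 (d i))

/-- The DoF region of the locally connected channel with transmit sets `T`: the closure of the
set of tuples that are achievable for almost all channel realizations. -/
def dofRegion (μ : Measure ℂ) (f : Fading) (L : ℕ) {K : ℕ} (T : Fin K → Finset (Fin K)) :
    Set (Fin K → ℝ) :=
  closure {d | ∀ᵐ g ∂(drawLaw μ K), DoFAchievable T (coeff L f g) d}

/-- The sums of degrees of freedom of the `K`-user channel, over all choices of transmit sets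
with at most `M` elements and all points of the DoF region. -/
def sumDoFs (μ : Measure ℂ) (f : Fading) (L M K : ℕ) : Set ℝ :=
  {s | ∃ T : Fin K → Finset (Fin K), (∀ i, (T i).card ≤ M) ∧
    ∃ d ∈ dofRegion μ f L T, s = ∑ i, d i}

/-- The number `η_L(K, M)` of degrees of freedom of the `K`-user channel with
cooperation order `M`. -/
def totalDoF (μ : Measure ℂ) (f : Fading) (L M K : ℕ) : ℝ :=
  sSup (sumDoFs μ f L M K)

end

end CoMP

/-!
Both bounds rest on clusters of `2 * M + 1` consecutive users, with the central receiver of a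
cluster playing a special role. In every complete cluster `2 * M` degrees of freedom are achieved
and no more are possible, while the incomplete last cluster does not matter in the limit.

*Converse.* Let message `b` belong to a central receiver. A transmitter makes use of message `b`
only if it is linked to receiver `b` by a run of transmitters that all know the message; elsewhere
the message can be replaced by a fixed one without loss (`exists_decoupled`). As such a run has at
most `M` elements, the boundary transmitters of the clusters may be taken not to use the messages
of the centres (`exists_local_signals`). So their signals are known once all receivers but the
centres have decoded. Starting from the two boundaries and solving the channel equations receiver
by receiver, one finds the signals of all transmitters up to noise, hence also the noiseless
signals of the centres (`norm_sub_predict_le`). Entropies are avoided by comparing volumes: the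
decision regions are disjoint, and all noise densities, restricted to their decision regions, lie
below a common function which is a Gaussian of width `√P` in the received signals of the ordinary
users and a Gaussian of constant width in the prediction errors of the centres
(`sum_noiseLaw_le`, `prod_size_le`). Its integral bounds the number of message tuples, so each
centre costs one degree of freedom (`sum_dof_le`). Slots with some coefficient close to zero or
large, for which the prediction is useless, have arbitrarily small frequency (`ae_regular`), and
the integrability of the positive logarithm of the coefficients keeps the volume filled by the
received signals exponential in the block length.

*Achievability.* The central receivers and the last transmitters of the clusters are switched off.
The other transmitters solve the same recursion with the wanted received signals as data, which
removes all interference and needs each message at `M` transmitters at most (`beamform`). What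
remains are noisy parallel channels. A square constellation with about `P` points and constant
spacing is used on them, protected against the rare bad slots and large noises by an outer code
from the Gilbert–Varshamov bound; this costs only a small fraction of the rate
(`rateAchievable_scheme`).

The DoF region is closed and bounded, and there are finitely many choices of transmit sets, hence
the maximum exists.
-/

namespace CoMP

/-! ### The density of the noise -/

theorem lintegral_ofReal_pi_prod {ι E : Type*} [Fintype ι] [MeasurableSpace E]
    (μ : ι → Measure E) [∀ i, SigmaFinite (μ i)] (f : ι → E → ℝ) (h0 : ∀ i x, 0 ≤ f i x)
    (hf : ∀ i, Integrable (f i) (μ i)) :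
    ∫⁻ x, ENNReal.ofReal (∏ i, f i (x i)) ∂(Measure.pi μ) =
      ∏ i, ∫⁻ x, ENNReal.ofReal (f i x) ∂(μ i) := by
  rw [← ofReal_integral_eq_lintegral_ofReal (Integrable.fintype_prod_dep hf)
    (ae_of_all _ fun x => Finset.prod_nonneg fun i _ => h0 i _),
    integral_fintype_prod_eq_prod,
    ENNReal.ofReal_prod_of_nonneg fun i _ => integral_nonneg (h0 i)]
  refine Finset.prod_congr rfl fun i _ => ?_
  rw [ofReal_integral_eq_lintegral_ofReal (hf i) (ae_of_all _ (h0 i))]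

theorem pi_withDensity_ofReal {ι E : Type*} [Fintype ι] [MeasurableSpace E]
    (μ : ι → Measure E) [∀ i, SigmaFinite (μ i)] (f : ι → E → ℝ) (h0 : ∀ i x, 0 ≤ f i x)
    (hf : ∀ i, Integrable (f i) (μ i)) :
    Measure.pi (fun i => (μ i).withDensity fun x => ENNReal.ofReal (f i x)) =
      (Measure.pi μ).withDensity fun x => ENNReal.ofReal (∏ i, f i (x i)) := by
  have : ∀ i, SigmaFinite ((μ i).withDensity fun x => ENNReal.ofReal (f i x)) := fun i =>
    SigmaFinite.withDensity_ofReal _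
  refine Measure.pi_eq fun s hs => ?_
  rw [withDensity_apply _ (MeasurableSet.univ_pi hs), Measure.restrict_pi_pi,
    lintegral_ofReal_pi_prod _ f h0 fun i => (hf i).restrict]
  refine Finset.prod_congr rfl fun i _ => ?_
  rw [withDensity_apply _ (hs i)]

theorem integrable_gaussian_complex {b : ℝ} (hb : 0 < b) :
    Integrable (fun z : ℂ => Real.pi⁻¹ * Real.exp (-b * ‖z‖ ^ 2)) := by
  refine Integrable.const_mul ?_ _
  have := (GaussianFourier.integrable_cexp_neg_mul_sq_norm_add (V := ℂ) (b := b)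
    (by simpa) 0 0).norm
  refine this.congr (ae_of_all _ fun z => ?_)
  have h : ((-b : ℂ) * (‖z‖ : ℂ) ^ 2) = ((-b * ‖z‖ ^ 2 : ℝ) : ℂ) := by push_cast; ring
  simp only [zero_mul, add_zero, h, Complex.norm_exp_ofReal]

theorem lintegral_gaussian_complex {b : ℝ} (hb : 0 < b) :
    ∫⁻ z : ℂ, ENNReal.ofReal (Real.pi⁻¹ * Real.exp (-b * ‖z‖ ^ 2)) = ENNReal.ofReal b⁻¹ := by
  rw [← ofReal_integral_eq_lintegral_ofReal (integrable_gaussian_complex hb)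
    (ae_of_all _ fun z => by positivity), integral_const_mul,
    GaussianFourier.integral_rexp_neg_mul_sq_norm hb]
  congr 1
  rw [Complex.finrank_real_complex]
  have := Real.pi_pos
  norm_num
  field_simp

theorem complexGaussian_eq_withDensity :
    complexGaussian = (volume : Measure ℂ).withDensity
      fun z => ENNReal.ofReal (Real.pi⁻¹ * Real.exp (-1 * ‖z‖ ^ 2)) := by
  unfold complexGaussian
  rw [gaussianReal_of_var_ne_zero _ (by norm_num),
    prod_withDensity (measurable_gaussianPDF _ _) (measurable_gaussianPDF _ _)]
  have h1 : (fun p : ℝ × ℝ => (⟨p.1, p.2⟩ : ℂ)) = Complex.measurableEquivRealProd.symm := by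
    ext p; simp
  rw [h1]
  refine Measure.ext fun s hs => ?_
  rw [Measure.map_apply Complex.measurableEquivRealProd.symm.measurable hs,
    withDensity_apply _ (Complex.measurableEquivRealProd.symm.measurable hs),
    withDensity_apply _ hs,
    ← Complex.volume_preserving_equiv_real_prod.symm.setLIntegral_comp_preimage_emb
      Complex.measurableEquivRealProd.symm.measurableEmbedding]
  refine lintegral_congr fun p => ?_
  rw [gaussianPDF, gaussianPDF, ← ENNReal.ofReal_mul (gaussianPDFReal_nonneg _ _ _)]
  congr 1
  simp only [gaussianPDFReal]
  have hpi := Real.pi_pos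
  rw [mul_mul_mul_comm, ← Real.exp_add, ← mul_inv, Real.mul_self_sqrt (by positivity),
    Complex.sq_norm, Complex.normSq_apply]
  simp only [Complex.measurableEquivRealProd_symm_apply]
  push_cast
  congr 2
  · ring
  · ring

theorem noiseLaw_eq_withDensity (K n : ℕ) :
    noiseLaw K n = volume.withDensity fun z : Fin K → Fin n → ℂ =>
      ENNReal.ofReal (∏ i, ∏ t, (Real.pi⁻¹ * Real.exp (-1 * ‖z i t‖ ^ 2))) := by
  have h0 : ∀ z : ℂ, 0 ≤ Real.pi⁻¹ * Real.exp (-1 * ‖z‖ ^ 2) := fun z => by positivity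
  unfold noiseLaw
  rw [complexGaussian_eq_withDensity,
    pi_withDensity_ofReal (fun _ : Fin n => (volume : Measure ℂ)) (fun _ z => _)
      (fun _ => h0) (fun _ => integrable_gaussian_complex one_pos),
    pi_withDensity_ofReal (fun _ : Fin K => Measure.pi fun _ : Fin n => (volume : Measure ℂ))
      (fun _ z => ∏ t, (Real.pi⁻¹ * Real.exp (-1 * ‖z t‖ ^ 2)))
      (fun _ z => Finset.prod_nonneg fun t _ => h0 _)
      (fun _ => Integrable.fintype_prod_dep
        (f := fun _ : Fin n => fun z : ℂ => Real.pi⁻¹ * Real.exp (-1 * ‖z‖ ^ 2))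
        fun _ => integrable_gaussian_complex one_pos)]
  rfl

/-! ### Triangular shifts preserve volume -/

/-- A shift of the coordinates in `B` by an amount that depends only on the other coordinates
preserves volume. -/
theorem lintegral_sub_triangular {ι E : Type*} [Fintype ι] [NormedAddCommGroup E]
    [MeasureSpace E] [BorelSpace E] [SecondCountableTopology E]
    [SigmaFinite (volume : Measure E)] [(volume : Measure E).IsAddRightInvariant]
    (B : Set ι) (k : (ι → E) → ι → E)
    (hk : Measurable k) (hkB : ∀ y y', (∀ i ∉ B, y i = y' i) → k y = k y')
    (hk0 : ∀ y, ∀ i ∉ B, k y i = 0) (F : (ι → E) → ENNReal) (hF : Measurable F) :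
    ∫⁻ y, F (y - k y) = ∫⁻ y, F y := by
  classical
  set e := MeasurableEquiv.piEquivPiSubtypeProd (fun _ : ι => E) (fun i => i ∉ B) with he
  have hp := (volume_preserving_piEquivPiSubtypeProd (fun _ : ι => E) (fun i => i ∉ B)).symm
  rw [← hp.lintegral_comp (f := fun y => F (y - k y)) (by fun_prop), ← hp.lintegral_comp hF,
    Measure.volume_eq_prod, lintegral_prod _ (by fun_prop), lintegral_prod _ (by fun_prop)]
  refine lintegral_congr fun a => ?_
  refine Eq.trans ?_ (lintegral_sub_right_eq_self (fun b => F (e.symm (a, b)))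
    fun i : {i // ¬ i ∉ B} => k (e.symm (a, 0)) i)
  refine lintegral_congr fun b => ?_
  have : k (e.symm (a, b)) = k (e.symm (a, 0)) := by
    refine hkB _ _ fun i hi => ?_
    simp [e, MeasurableEquiv.piEquivPiSubtypeProd, Equiv.piEquivPiSubtypeProd, hi]
  rw [← he, this]
  congr 1
  funext i
  by_cases hi : i ∈ B
  · simp [e, MeasurableEquiv.piEquivPiSubtypeProd, Equiv.piEquivPiSubtypeProd, hi]
  · simp [e, MeasurableEquiv.piEquivPiSubtypeProd, Equiv.piEquivPiSubtypeProd, hi, hk0]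

/-! ### The volume bound -/

/-- The volume under a product of Gaussians, normalized so that weight one gives one. -/
theorem lintegral_gaussian_weights {K n : ℕ} (l : Fin K → Fin n → ℝ) (hl : ∀ i t, 0 < l i t) :
    ∫⁻ y : Fin K → Fin n → ℂ,
        ENNReal.ofReal (∏ i, ∏ t, (Real.pi⁻¹ * Real.exp (-l i t * ‖y i t‖ ^ 2))) =
      ENNReal.ofReal (∏ i, ∏ t, (l i t)⁻¹) := by
  have h0 : ∀ (b : ℝ) (z : ℂ), 0 ≤ Real.pi⁻¹ * Real.exp (-b * ‖z‖ ^ 2) :=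
    fun b z => by positivity
  have h1 := lintegral_ofReal_pi_prod (fun _ : Fin K => (volume : Measure (Fin n → ℂ)))
    (fun i z => ∏ t, (Real.pi⁻¹ * Real.exp (-l i t * ‖z t‖ ^ 2)))
    (fun i z => Finset.prod_nonneg fun t _ => h0 _ _)
    (fun i => Integrable.fintype_prod_dep
      (f := fun t : Fin n => fun z : ℂ => Real.pi⁻¹ * Real.exp (-l i t * ‖z‖ ^ 2))
      fun t => integrable_gaussian_complex (hl i t))
  refine h1.trans ?_
  rw [ENNReal.ofReal_prod_of_nonneg
    fun i _ => Finset.prod_nonneg fun t _ => (inv_pos.2 (hl i t)).le]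
  refine Finset.prod_congr rfl fun i _ => ?_
  refine (lintegral_ofReal_pi_prod (fun _ : Fin n => (volume : Measure ℂ))
    (fun t z => Real.pi⁻¹ * Real.exp (-l i t * ‖z‖ ^ 2)) (fun t z => h0 _ _)
    fun t => integrable_gaussian_complex (hl i t)).trans ?_
  rw [ENNReal.ofReal_prod_of_nonneg fun t _ => (inv_pos.2 (hl i t)).le]
  exact Finset.prod_congr rfl fun t _ => lintegral_gaussian_complex (hl i t)

/-- A counting bound that takes the place of Fano's inequality. Disjoint decision regions `D w`
share the integral of one Gaussian-like function which dominates all the noise densities centred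
at the codewords. The function is a Gaussian with weights `l` in the received signals, those
indexed by `B` being taken relative to a prediction `k` from the remaining ones. -/
theorem sum_noiseLaw_le {K n : ℕ} {W : Type*} [Fintype W] (mean : W → Fin K → Fin n → ℂ)
    (D : W → Set (Fin K → Fin n → ℂ)) (hD : ∀ w, MeasurableSet (D w))
    (hdisj : Pairwise (Function.onFun Disjoint D)) (B : Set (Fin K))
    (k : (Fin K → Fin n → ℂ) → Fin K → Fin n → ℂ) (hk : Measurable k)
    (hkB : ∀ y y', (∀ i ∉ B, y i = y' i) → k y = k y') (hk0 : ∀ y, ∀ i ∉ B, k y i = 0)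
    (l : Fin K → Fin n → ℝ) (hl : ∀ i t, 0 < l i t) (c : ℝ)
    (h : ∀ w, ∀ y ∈ D w, ∑ i, ∑ t, l i t * ‖y i t - k y i t‖ ^ 2 ≤
      ∑ i, ∑ t, ‖y i t - mean w i t‖ ^ 2 + c) :
    ∑ w, noiseLaw K n {z | mean w + z ∈ D w} ≤
      ENNReal.ofReal (Real.exp c * ∏ i, ∏ t, (l i t)⁻¹) := by
  have hexp : ∀ (b : Fin K → Fin n → ℝ) (y : Fin K → Fin n → ℂ),
      ∏ i, ∏ t, (Real.pi⁻¹ * Real.exp (-b i t * ‖y i t‖ ^ 2)) =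
        (∏ _i : Fin K, ∏ _t : Fin n, Real.pi⁻¹) *
          Real.exp (-∑ i, ∑ t, b i t * ‖y i t‖ ^ 2) := by
    intro b y
    simp only [Finset.prod_mul_distrib, ← Real.exp_sum, neg_mul, Finset.sum_neg_distrib]
  set G : (Fin K → Fin n → ℂ) → ENNReal := fun y =>
    ENNReal.ofReal (∏ i, ∏ t, (Real.pi⁻¹ * Real.exp (-l i t * ‖y i t‖ ^ 2))) with hG
  have hGm : Measurable G := by fun_prop
  have hw : ∀ w, noiseLaw K n {z | mean w + z ∈ D w} ≤
      ∫⁻ y in D w, ENNReal.ofReal (Real.exp c) * G (y - k y) := by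
    intro w
    have hS : MeasurableSet {z | mean w + z ∈ D w} := (measurable_const_add (mean w)) (hD w)
    rw [noiseLaw_eq_withDensity, withDensity_apply _ hS, ← lintegral_indicator hS,
      ← lintegral_indicator (hD w)]
    refine le_of_le_of_eq ?_ (lintegral_add_left_eq_self _ (mean w))
    refine lintegral_mono fun z => ?_
    by_cases hz : mean w + z ∈ D w
    · rw [Set.indicator_of_mem (show z ∈ {z | mean w + z ∈ D w} from hz),
        Set.indicator_of_mem hz, hG, ← ENNReal.ofReal_mul (Real.exp_pos c).le]
      refine ENNReal.ofReal_le_ofReal ?_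
      rw [hexp (fun _ _ => 1), hexp l, mul_left_comm, ← Real.exp_add]
      refine mul_le_mul_of_nonneg_left (Real.exp_le_exp.2 ?_)
        (Finset.prod_nonneg fun _ _ => Finset.prod_nonneg fun _ _ => by positivity)
      have := h w _ hz
      simp only [Pi.add_apply, add_sub_cancel_left, Pi.sub_apply, one_mul] at this ⊢
      linarith
    · rw [Set.indicator_of_notMem (show z ∉ {z | mean w + z ∈ D w} from hz)]
      exact zero_le
  calc ∑ w, noiseLaw K n {z | mean w + z ∈ D w}
      ≤ ∑ w, ∫⁻ y in D w, ENNReal.ofReal (Real.exp c) * G (y - k y) :=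
        Finset.sum_le_sum fun w _ => hw w
    _ = ∫⁻ y in ⋃ w, D w, ENNReal.ofReal (Real.exp c) * G (y - k y) := by
        rw [lintegral_iUnion hD hdisj, tsum_fintype]
    _ ≤ ∫⁻ y, ENNReal.ofReal (Real.exp c) * G (y - k y) := setLIntegral_le_lintegral _ _
    _ = ENNReal.ofReal (Real.exp c) * ∫⁻ y, G (y - k y) :=
        lintegral_const_mul _ (hGm.comp (measurable_id.sub hk))
    _ = ENNReal.ofReal (Real.exp c) * ∫⁻ y, G y := by
        rw [lintegral_sub_triangular B k hk hkB hk0 G hGm]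
    _ = _ := by
        rw [hG, lintegral_gaussian_weights l hl, ENNReal.ofReal_mul (Real.exp_pos c).le]

/-! ### Removing useless knowledge from the transmitters -/

/-- The probability that receiver `i` errs on the message tuple `w` when the signals `x` are
sent. -/
noncomputable def pairError {K n : ℕ} {T : Fin K → Finset (Fin K)} {P : ℝ} (c : Code K n T P)
    (H : ℕ → Matrix (Fin K) (Fin K) ℂ) (x : Fin K → (∀ i, Fin (c.size i)) → Fin n → ℂ)
    (i : Fin K) (w : ∀ i, Fin (c.size i)) : ℝ :=
  (noiseLaw K n).real {z | c.dec i (received H (fun j => x j w) z i) ≠ w i}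

/-- If the part of the transmit set of message `b` marked by `inside b` shares no receiver with
the unmarked part, and receiver `b` hears only the marked part, then the unmarked transmitters
can do without message `b`. They use a fixed substitute `w' b` instead: with a random independent
substitute every receiver would see the same statistics as before, so some fixed substitute is
at least as good. -/
theorem exists_decoupled {K n : ℕ} {T : Fin K → Finset (Fin K)} {P : ℝ} (c : Code K n T P)
    (H : ℕ → Matrix (Fin K) (Fin K) ℂ) (hears : Fin K → Fin K → Prop)
    (hH : ∀ t i j, ¬ hears i j → H t i j = 0) (inside : Fin K → Fin K → Prop)
    (h1 : ∀ b i j j', hears i j → hears i j' → j ∈ T b → j' ∈ T b → inside b j → inside b j')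
    (h2 : ∀ b j, hears b j → j ∈ T b → inside b j) :
    ∃ x : Fin K → (∀ i, Fin (c.size i)) → Fin n → ℂ,
      (∀ j w, ∑ t, ‖x j w t‖ ^ 2 ≤ n * P) ∧
      (∀ j w w', (∀ i, j ∈ T i → inside i j → w i = w' i) → x j w = x j w') ∧
      ∑ w, ∑ i, pairError c H x i w ≤ ∑ w, ∑ i, pairError c H c.enc i w := by
  classical
  rcases isEmpty_or_nonempty (∀ i, Fin (c.size i)) with hW | hW
  · exact ⟨c.enc, c.power_le, fun j w => (hW.false w).elim, le_rfl⟩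
  -- the tuple used by transmitter `j`, and the one that receiver `i` believes to be in use
  let mixT : Fin K → (∀ i, Fin (c.size i)) → (∀ i, Fin (c.size i)) → ∀ i, Fin (c.size i) :=
    fun j w w' b => if inside b j then w b else w' b
  let own : Fin K → Fin K → Prop := fun i b =>
    b = i ∨ ∃ j, hears i j ∧ j ∈ T b ∧ inside b j
  let mixR : Fin K → (∀ i, Fin (c.size i)) → (∀ i, Fin (c.size i)) → ∀ i, Fin (c.size i) :=
    fun i w w' b => if own i b then w b else w' b
  have hmix : ∀ i j w w', hears i j → c.enc j (mixT j w w') = c.enc j (mixR i w w') := by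
    intro i j w w' hij
    refine c.enc_eq j _ _ fun b hb => ?_
    by_cases hin : inside b j
    · have : own i b := Or.inr ⟨j, hij, hb, hin⟩
      simp [mixT, mixR, hin, this]
    · have : ¬ own i b := by
        rintro (rfl | ⟨j', hj', hjb, hin'⟩)
        · exact hin (h2 _ _ hij hb)
        · exact hin (h1 _ _ _ _ hj' hij hjb hb hin')
      simp [mixT, mixR, hin, this]
  have herr : ∀ i w w', pairError c H (fun j w => c.enc j (mixT j w w')) i w =
      pairError c H c.enc i (mixR i w w') := by
    intro i w w'
    have h3 : ∀ z : Fin K → Fin n → ℂ, received H (fun j => c.enc j (mixT j w w')) z i =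
        received H (fun j => c.enc j (mixR i w w')) z i := by
      intro z
      funext t
      unfold received
      congr 1
      refine Finset.sum_congr rfl fun j _ => ?_
      by_cases hij : hears i j
      · exact congrArg (fun v => H t i j * v t) (hmix i j w w' hij)
      · simp [hH _ _ _ hij]
    have h4 : mixR i w w' i = w i := by simp [mixR, own]
    simp only [pairError, h3, h4]
  have hswap : ∀ i, ∑ w', ∑ w, pairError c H c.enc i (mixR i w w') =
      ∑ _w' : (∀ i, Fin (c.size i)), ∑ w, pairError c H c.enc i w := by
    intro i
    rw [← Fintype.sum_prod_type', ← Fintype.sum_prod_type']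
    let φ : (∀ i, Fin (c.size i)) × (∀ i, Fin (c.size i)) →
        (∀ i, Fin (c.size i)) × (∀ i, Fin (c.size i)) :=
      fun p => (mixR i p.1 p.2, mixR i p.2 p.1)
    have hφ : Function.Involutive φ := by
      rintro ⟨u, v⟩
      refine Prod.ext (funext fun b => ?_) (funext fun b => ?_) <;>
        by_cases hb : own i b <;> simp [φ, mixR, hb]
    refine Fintype.sum_bijective φ hφ.bijective _ _ ?_
    rintro ⟨u, v⟩
    rfl
  have hsum : ∑ w', ∑ w, ∑ i, pairError c H (fun j w => c.enc j (mixT j w w')) i w =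
      ∑ _w' : (∀ i, Fin (c.size i)), ∑ w, ∑ i, pairError c H c.enc i w := by
    simp only [herr]
    have h5 : ∀ F : (∀ i, Fin (c.size i)) → (∀ i, Fin (c.size i)) → Fin K → ℝ,
        ∑ w', ∑ w, ∑ i, F w' w i = ∑ i, ∑ w', ∑ w, F w' w i := by
      intro F
      rw [Finset.sum_comm (s := (Finset.univ : Finset (Fin K)))]
      exact Finset.sum_congr rfl fun w' _ => Finset.sum_comm
    rw [h5, h5]
    exact Finset.sum_congr rfl fun i _ => hswap i
  obtain ⟨w', -, hw'⟩ := Finset.exists_le_of_sum_le Finset.univ_nonempty hsum.le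
  refine ⟨fun j w => c.enc j (mixT j w w'), fun j w => c.power_le _ _, fun j u v huv => ?_, hw'⟩
  refine c.enc_eq j _ _ fun b hb => ?_
  by_cases hin : inside b j
  · simp [mixT, hin, huv b hb hin]
  · simp [mixT, hin]

theorem connected_one_iff {K : ℕ} (i j : Fin K) :
    Connected 1 i j ↔ (i : ℕ) = j ∨ (i : ℕ) = j + 1 := by
  unfold Connected
  omega

/-- In Wyner's asymmetric model, message `b` is of use only at the transmitters from `b - M` to
`b + M - 1`: to matter, a transmitter has to be linked to receiver `b` by an unbroken run of
transmitters that know the message, and such a run has at most `M` elements. -/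
theorem exists_local_signals {K n M : ℕ} {T : Fin K → Finset (Fin K)} (hT : ∀ i, (T i).card ≤ M)
    {P : ℝ} (c : Code K n T P) (f : Fading) (g : ℕ × Fin K × Fin K → ℂ) :
    ∃ x : Fin K → (∀ i, Fin (c.size i)) → Fin n → ℂ,
      (∀ j w, ∑ t, ‖x j w t‖ ^ 2 ≤ n * P) ∧
      (∀ (j : Fin K) w w', (∀ i : Fin K, (i : ℕ) ≤ j + M → (j : ℕ) + 1 ≤ i + M → w i = w' i) →
        x j w = x j w') ∧
      ∑ w, ∑ i, pairError c (coeff 1 f g) x i w ≤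
        ∑ w, ∑ i, pairError c (coeff 1 f g) c.enc i w := by
  obtain ⟨x, hx1, hx2, hx3⟩ := exists_decoupled c (coeff 1 f g) (Connected 1)
    (fun t i j hij => by simp [coeff, hij])
    (fun b j => ∀ m : Fin K, (j ≤ m ∧ m < b) ∨ (b ≤ m ∧ m ≤ j) → m ∈ T b)
    (by
      intro b i j j' hij hij' hj hj' hin m hm
      rw [connected_one_iff] at hij hij'
      by_cases h : m = j'
      · exact h ▸ hj'
      · by_cases h' : m = j
        · exact h' ▸ hj
        · apply hin
          simp only [Fin.le_def, Fin.lt_def, Fin.ext_iff] at *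
          omega)
    (by
      intro b j hbj hj m hm
      rw [connected_one_iff] at hbj
      have : m = j := by
        simp only [Fin.le_def, Fin.lt_def, Fin.ext_iff] at *
        omega
      exact this ▸ hj)
  refine ⟨x, hx1, fun (j : Fin K) w w' h => hx2 j w w' fun i _ hin => h i ?_ ?_, hx3⟩
  · have hs : Finset.Ico j i ⊆ T i := fun m hm => hin m (Or.inl (Finset.mem_Ico.1 hm))
    have := (Finset.card_le_card hs).trans (hT i)
    rw [Fin.card_Ico] at this
    omega
  · have hs : Finset.Icc i j ⊆ T i := fun m hm => hin m (Or.inr (Finset.mem_Icc.1 hm))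
    have := (Finset.card_le_card hs).trans (hT i)
    rw [Fin.card_Icc] at this
    omega

/-! ### Solving for the transmit signals along the line -/

/-- The solution `x` of the recursion `a s * x (s + 1) + b s * x s = σ s` with `x 0 = x₀`. -/
noncomputable def sweep (a b σ : ℕ → ℂ) (x₀ : ℂ) : ℕ → ℂ
  | 0 => x₀
  | s + 1 => (σ s - b s * sweep a b σ x₀ s) / a s

theorem sweep_spec {a b σ : ℕ → ℂ} {x₀ : ℂ} {s : ℕ} (ha : a s ≠ 0) :
    a s * sweep a b σ x₀ (s + 1) + b s * sweep a b σ x₀ s = σ s := by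
  rw [sweep]
  field_simp
  ring

/-- The recursion is linear: if the data are those of a sequence `x` plus a disturbance `z`, the
solution differs from `x` by the solution for `z`. -/
theorem sweep_sub {a b σ x z : ℕ → ℂ} {m : ℕ} (ha : ∀ s < m, a s ≠ 0)
    (h : ∀ s < m, a s * x (s + 1) + b s * x s + z s = σ s) :
    ∀ s ≤ m, sweep a b σ (x 0) s - x s = sweep a b z 0 s := by
  intro s
  induction s with
  | zero => simp [sweep]
  | succ s ih =>
    intro hs
    have h0 := ha s hs
    rw [sweep, sweep, ← ih (by omega), ← h s hs]
    field_simp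
    ring

theorem norm_sweep_le {a b σ : ℕ → ℂ} {δ : ℝ} (hδ : 0 < δ) (hδ1 : δ ≤ 1) {m : ℕ}
    (ha : ∀ s < m, δ ≤ ‖a s‖) (hb : ∀ s < m, ‖b s‖ ≤ δ⁻¹) {S : ℝ} (hσ : ∀ s < m, ‖σ s‖ ≤ S) :
    ∀ s ≤ m, ‖sweep a b σ 0 s‖ ≤ s * (δ⁻¹ ^ 2) ^ s * S := by
  have h1 : 1 ≤ δ⁻¹ := (one_le_inv₀ hδ).2 hδ1
  intro s
  induction s with
  | zero => simp [sweep]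
  | succ s ih =>
    intro hs
    have hS : 0 ≤ S := (norm_nonneg _).trans (hσ s hs)
    have ih := ih (by omega)
    have ha' := ha s hs
    rw [sweep, norm_div, div_le_iff₀ (hδ.trans_le ha')]
    have h2 : ‖σ s - b s * sweep a b σ 0 s‖ ≤ S + δ⁻¹ * (s * (δ⁻¹ ^ 2) ^ s * S) := by
      refine (norm_sub_le _ _).trans (add_le_add (hσ s hs) ?_)
      rw [norm_mul]
      exact mul_le_mul (hb s hs) ih (norm_nonneg _) (by positivity)
    refine h2.trans ?_
    have h3 : (↑(s + 1) * (δ⁻¹ ^ 2) ^ (s + 1) * S) * δ ≤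
        (↑(s + 1) * (δ⁻¹ ^ 2) ^ (s + 1) * S) * ‖a s‖ :=
      mul_le_mul_of_nonneg_left ha' (by positivity)
    refine le_trans ?_ h3
    have h4 : (δ⁻¹ ^ 2) ^ (s + 1) * δ = (δ⁻¹ ^ 2) ^ s * δ⁻¹ := by
      rw [pow_succ, pow_two δ⁻¹]; field_simp
    have h5 : 1 ≤ (δ⁻¹ ^ 2) ^ s * δ⁻¹ := one_le_mul_of_one_le_of_one_le
      (one_le_pow₀ (one_le_pow₀ h1)) h1
    have h6 : (↑(s + 1) * (δ⁻¹ ^ 2) ^ (s + 1) * S) * δ =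
        ((δ⁻¹ ^ 2) ^ s * δ⁻¹) * S + δ⁻¹ * (s * (δ⁻¹ ^ 2) ^ s * S) := by
      rw [show (↑(s + 1) * (δ⁻¹ ^ 2) ^ (s + 1) * S) * δ =
        ↑(s + 1) * ((δ⁻¹ ^ 2) ^ (s + 1) * δ) * S by ring, h4]
      push_cast
      ring
    rw [h6]
    have := le_mul_of_one_le_left hS h5
    linarith

theorem measurable_sweep {Y : Type*} [MeasurableSpace Y] {a b : ℕ → ℂ} {σ : Y → ℕ → ℂ}
    {x₀ : Y → ℂ} (hσ : ∀ s, Measurable fun y => σ y s) (hx : Measurable x₀) (s : ℕ) :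
    Measurable fun y => sweep a b (σ y) (x₀ y) s := by
  induction s with
  | zero => exact hx
  | succ s ih =>
    simp only [sweep]
    exact ((hσ s).sub (ih.const_mul _)).div_const _

theorem sweep_congr {a b σ σ' : ℕ → ℂ} {x₀ : ℂ} {m : ℕ} (h : ∀ s < m, σ s = σ' s) :
    ∀ s ≤ m, sweep a b σ x₀ s = sweep a b σ' x₀ s := by
  intro s
  induction s with
  | zero => exact fun _ => rfl
  | succ s ih => intro hs; rw [sweep, sweep, ih (by omega), h s hs]

/-- The extension of a finite family by zero. -/
def extend {K : ℕ} (x : Fin K → ℂ) (m : ℕ) : ℂ := if h : m < K then x ⟨m, h⟩ else 0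

@[simp]
theorem extend_val {K : ℕ} (x : Fin K → ℂ) (i : Fin K) : extend x i = x i := by
  simp [extend]

/-- The signals of the transmitters with indices shifted by one: `shifted x (j + 1) = x j`, and
`shifted x 0 = 0` stands for the absent transmitter in front of the first receiver. -/
def shifted {K : ℕ} (x : Fin K → ℂ) : ℕ → ℂ
  | 0 => 0
  | m + 1 => extend x m

/-- The coefficient from transmitter `i` to receiver `i`. -/
def direct {K : ℕ} (A : Matrix (Fin K) (Fin K) ℂ) : ℕ → ℂ := extend fun i => A i i

/-- The coefficient from transmitter `i - 1` to receiver `i`. -/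
def cross {K : ℕ} (A : Matrix (Fin K) (Fin K) ℂ) : ℕ → ℂ :=
  extend fun i => if (i : ℕ) = 0 then 0 else A i ⟨i - 1, by omega⟩

/-- The channel equation of Wyner's asymmetric model. -/
theorem sum_coeff_mul {K : ℕ} (f : Fading) (g : ℕ × Fin K × Fin K → ℂ) (t : ℕ) (x : Fin K → ℂ)
    (i : Fin K) :
    ∑ j, coeff 1 f g t i j * x j =
      direct (coeff 1 f g t) i * shifted x (i + 1) + cross (coeff 1 f g t) i * shifted x i := by
  have h1 : direct (coeff 1 f g t) i * shifted x (i + 1) = coeff 1 f g t i i * x i := by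
    simp [direct, shifted]
  rw [h1, ← Finset.add_sum_erase _ _ (Finset.mem_univ i)]
  congr 1
  rcases i with ⟨_ | i, hi⟩
  · rw [Finset.sum_eq_zero]
    · simp [shifted]
    · intro j hj
      have : ¬ Connected 1 (⟨0, hi⟩ : Fin K) j := by
        rw [connected_one_iff]
        have := Finset.ne_of_mem_erase hj
        simp only [ne_eq, Fin.ext_iff] at this ⊢
        omega
      simp [coeff, this]
  · have hi' : i < K := by omega
    rw [Finset.sum_eq_single (⟨i, hi'⟩ : Fin K)]
    · simp [cross, shifted, extend, hi, hi']
    · intro j hj hne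
      have : ¬ Connected 1 (⟨i + 1, hi⟩ : Fin K) j := by
        rw [connected_one_iff]
        have := Finset.ne_of_mem_erase hj
        simp only [ne_eq, Fin.ext_iff] at this hne ⊢
        omega
      simp [coeff, this]
    · intro h
      simp [Fin.ext_iff] at h

/-- A time slot is `δ`-good if the absolute values of all channel coefficients that matter lie
between `δ` and `δ⁻¹`. -/
def GoodSlot (δ : ℝ) {K : ℕ} (A : Matrix (Fin K) (Fin K) ℂ) : Prop :=
  ∀ i j, Connected 1 i j → δ ≤ ‖A i j‖ ∧ ‖A i j‖ ≤ δ⁻¹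

theorem GoodSlot.norm_direct {δ : ℝ} {K : ℕ} {A : Matrix (Fin K) (Fin K) ℂ} (h : GoodSlot δ A)
    {m : ℕ} (hm : m < K) : δ ≤ ‖direct A m‖ ∧ ‖direct A m‖ ≤ δ⁻¹ := by
  simp only [direct, extend, hm, dite_true]
  exact h _ _ (by rw [connected_one_iff]; simp)

theorem GoodSlot.norm_cross {δ : ℝ} {K : ℕ} {A : Matrix (Fin K) (Fin K) ℂ} (h : GoodSlot δ A)
    {m : ℕ} (hm : m < K) (h0 : m ≠ 0) : δ ≤ ‖cross A m‖ ∧ ‖cross A m‖ ≤ δ⁻¹ := by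
  simp only [cross, extend, hm, dite_true, h0, if_false]
  exact h _ _ (by rw [connected_one_iff]; simp only; omega)

theorem GoodSlot.norm_cross_le {δ : ℝ} (hδ : 0 < δ) {K : ℕ} {A : Matrix (Fin K) (Fin K) ℂ}
    (h : GoodSlot δ A) {m : ℕ} (hm : m < K) : ‖cross A m‖ ≤ δ⁻¹ := by
  by_cases h0 : m = 0
  · have : cross A m = 0 := by simp [cross, extend, h0]
    rw [this, norm_zero]
    positivity
  · exact (h.norm_cross hm h0).2

/-! ### Predicting the central receiver of a cluster

A cluster is a block of `2 * M + 1` consecutive users, its central receiver has the offset `M`.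
The signals next to the centre are found from the two boundaries of the cluster. -/

/-- The solution of the channel equations of the receivers `o, …, o + M - 1` for the received
signals `σ`, starting from the signal `x₀` of transmitter `o - 1`. The value at `s` belongs to
transmitter `o + s - 1`. -/
noncomputable def sweepUp {K : ℕ} (A : Matrix (Fin K) (Fin K) ℂ) (o : ℕ) (σ : ℕ → ℂ)
    (x₀ : ℂ) : ℕ → ℂ :=
  sweep (fun s => direct A (o + s)) (fun s => cross A (o + s)) (fun s => σ (o + s)) x₀

/-- The solution of the channel equations of the receivers `o + 2 * M, …, o + M + 1` for the
received signals `σ`, starting from the signal `x₀` of transmitter `o + 2 * M`. The value at `s`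
belongs to transmitter `o + 2 * M - s`. -/
noncomputable def sweepDown {K : ℕ} (M : ℕ) (A : Matrix (Fin K) (Fin K) ℂ) (o : ℕ) (σ : ℕ → ℂ)
    (x₀ : ℂ) : ℕ → ℂ :=
  sweep (fun s => cross A (o + 2 * M - s)) (fun s => direct A (o + 2 * M - s))
    (fun s => σ (o + 2 * M - s)) x₀

/-- The signal that the central receiver of the cluster with offset `o` would get without noise,
computed from the signals `σ` of the other receivers of the cluster and from the
signals `x₀`, `x₁` of the two boundary transmitters. -/
noncomputable def predict {K : ℕ} (M : ℕ) (A : Matrix (Fin K) (Fin K) ℂ) (o : ℕ) (σ : ℕ → ℂ)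
    (x₀ x₁ : ℂ) : ℂ :=
  direct A (o + M) * sweepDown M A o σ x₁ M + cross A (o + M) * sweepUp A o σ x₀ M

theorem predict_congr {K M : ℕ} {A : Matrix (Fin K) (Fin K) ℂ} {o : ℕ} {σ σ' : ℕ → ℂ}
    {x₀ x₁ : ℂ} (h : ∀ s ≤ 2 * M, s ≠ M → σ (o + s) = σ' (o + s)) :
    predict M A o σ x₀ x₁ = predict M A o σ' x₀ x₁ := by
  unfold predict sweepDown sweepUp
  rw [sweep_congr (σ' := fun s => σ' (o + s)) (fun s hs => h s (by omega) (by omega)) M le_rfl,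
    sweep_congr (σ' := fun s => σ' (o + 2 * M - s)) (fun s hs => ?_) M le_rfl]
  have := h (2 * M - s) (by omega) (by omega)
  rwa [← Nat.add_sub_assoc (by omega)] at this

theorem measurable_predict {Y : Type*} [MeasurableSpace Y] {K M : ℕ}
    {A : Matrix (Fin K) (Fin K) ℂ} {o : ℕ} {σ : Y → ℕ → ℂ} {x₀ x₁ : Y → ℂ}
    (hσ : ∀ s, Measurable fun y => σ y s) (h₀ : Measurable x₀) (h₁ : Measurable x₁) :
    Measurable fun y => predict M A o (σ y) (x₀ y) (x₁ y) := by
  unfold predict sweepDown sweepUp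
  exact ((measurable_sweep (fun s => hσ _) h₁ M).const_mul _).add
    ((measurable_sweep (fun s => hσ _) h₀ M).const_mul _)

/-- In a good slot the prediction error is a bounded combination of the noises. -/
theorem norm_sub_predict_le {K M : ℕ} {A : Matrix (Fin K) (Fin K) ℂ} {δ : ℝ}
    (hδ : 0 < δ) (hδ1 : δ ≤ 1) (hA : GoodSlot δ A) {o : ℕ} (ho : o + 2 * M < K)
    {ξ z σ : ℕ → ℂ}
    (h : ∀ i < K, σ i = direct A i * ξ (i + 1) + cross A i * ξ i + z i) {S : ℝ}
    (hS : ∀ i < K, ‖z i‖ ≤ S) :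
    ‖σ (o + M) - predict M A o σ (ξ o) (ξ (o + 2 * M + 1))‖ ≤
      (1 + 2 * (δ⁻¹ * (M * (δ⁻¹ ^ 2) ^ M))) * S := by
  have hup : sweepUp A o σ (ξ o) M - ξ (o + M) = sweepUp A o z 0 M := by
    refine sweep_sub (x := fun s => ξ (o + s)) (m := M) (fun s hs => ?_) (fun s hs => ?_) M le_rfl
    · exact norm_pos_iff.1 (hδ.trans_le (hA.norm_direct (by omega)).1)
    · exact (h (o + s) (by omega)).symm
  have hdown : sweepDown M A o σ (ξ (o + 2 * M + 1)) M - ξ (o + M + 1) =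
      sweepDown M A o z 0 M := by
    have := sweep_sub (a := fun s => cross A (o + 2 * M - s))
      (b := fun s => direct A (o + 2 * M - s)) (σ := fun s => σ (o + 2 * M - s))
      (z := fun s => z (o + 2 * M - s))
      (x := fun s => ξ (o + 2 * M + 1 - s)) (m := M) (fun s hs => ?_) (fun s hs => ?_) M le_rfl
    · have e : o + 2 * M + 1 - M = o + M + 1 := by omega
      rw [e] at this
      exact this
    · exact norm_pos_iff.1 (hδ.trans_le (hA.norm_cross (by omega) (by omega)).1)
    · have e1 : o + 2 * M + 1 - (s + 1) = o + 2 * M - s := by omega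
      have e2 : o + 2 * M + 1 - s = o + 2 * M - s + 1 := by omega
      rw [e1, e2, h _ (by omega)]
      ring
  have key : σ (o + M) - predict M A o σ (ξ o) (ξ (o + 2 * M + 1)) =
      z (o + M) - (direct A (o + M) * sweepDown M A o z 0 M +
        cross A (o + M) * sweepUp A o z 0 M) := by
    rw [← hup, ← hdown, predict, h (o + M) (by omega)]
    ring
  have hup' : ‖sweepUp A o z 0 M‖ ≤ M * (δ⁻¹ ^ 2) ^ M * S :=
    norm_sweep_le hδ hδ1 (m := M) (fun s hs => (hA.norm_direct (by omega)).1)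
      (fun s hs => hA.norm_cross_le hδ (by omega)) (fun s hs => hS _ (by omega)) M le_rfl
  have hdown' : ‖sweepDown M A o z 0 M‖ ≤ M * (δ⁻¹ ^ 2) ^ M * S :=
    norm_sweep_le hδ hδ1 (m := M) (fun s hs => (hA.norm_cross (by omega) (by omega)).1)
      (fun s hs => (hA.norm_direct (by omega)).2) (fun s hs => hS _ (by omega)) M le_rfl
  have hi : 0 ≤ δ⁻¹ := by positivity
  rw [key]
  calc _ ≤ ‖z (o + M)‖ + (‖direct A (o + M) * sweepDown M A o z 0 M‖ +
        ‖cross A (o + M) * sweepUp A o z 0 M‖) :=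
        (norm_sub_le _ _).trans (add_le_add le_rfl (norm_add_le _ _))
    _ ≤ S + (δ⁻¹ * (M * (δ⁻¹ ^ 2) ^ M * S) + δ⁻¹ * (M * (δ⁻¹ ^ 2) ^ M * S)) := by
        rw [norm_mul, norm_mul]
        exact add_le_add (hS _ (by omega)) (add_le_add
          (mul_le_mul (hA.norm_direct (by omega)).2 hdown' (norm_nonneg _) hi)
          (mul_le_mul (hA.norm_cross_le hδ (by omega)) hup' (norm_nonneg _) hi))
    _ = _ := by ring

/-! ### The converse for one block -/

instance isProbabilityMeasure_complexGaussian : IsProbabilityMeasure complexGaussian := by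
  unfold complexGaussian
  refine Measure.isProbabilityMeasure_map (Measurable.aemeasurable ?_)
  exact Complex.measurableEquivRealProd.symm.measurable

instance isProbabilityMeasure_noiseLaw (K n : ℕ) : IsProbabilityMeasure (noiseLaw K n) := by
  unfold noiseLaw
  infer_instance

/-- The noiseless received signals. -/
def noiseless {K n : ℕ} (H : ℕ → Matrix (Fin K) (Fin K) ℂ) (x : Fin K → Fin n → ℂ) :
    Fin K → Fin n → ℂ :=
  fun i t => ∑ j, H t i j * x j t

/-- The received signals for which all receivers decide in favour of `w`. -/
def Code.region {K n : ℕ} {T : Fin K → Finset (Fin K)} {P : ℝ} (c : Code K n T P)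
    (w : ∀ i, Fin (c.size i)) : Set (Fin K → Fin n → ℂ) :=
  {y | ∀ i, c.dec i (y i) = w i}

theorem Code.measurableSet_region {K n : ℕ} {T : Fin K → Finset (Fin K)} {P : ℝ}
    (c : Code K n T P) (w : ∀ i, Fin (c.size i)) : MeasurableSet (c.region w) := by
  have : c.region w = ⋂ i, (fun y : Fin K → Fin n → ℂ => c.dec i (y i)) ⁻¹' {w i} := by
    ext y; simp [Code.region]
  rw [this]
  exact MeasurableSet.iInter fun i =>
    ((c.measurable_dec i).comp (measurable_pi_apply i)) (measurableSet_singleton _)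

/-- The union bound for the probability that all receivers decide correctly. -/
theorem one_sub_sum_pairError_le {K n : ℕ} {T : Fin K → Finset (Fin K)} {P : ℝ}
    (c : Code K n T P) (H : ℕ → Matrix (Fin K) (Fin K) ℂ)
    (x : Fin K → (∀ i, Fin (c.size i)) → Fin n → ℂ) (w : ∀ i, Fin (c.size i)) :
    1 - ∑ i, pairError c H x i w ≤
      (noiseLaw K n).real {z | noiseless H (fun j => x j w) + z ∈ c.region w} := by
  have hm : MeasurableSet {z | noiseless H (fun j => x j w) + z ∈ c.region w} :=
    (measurable_const_add _) (c.measurableSet_region w)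
  have h1 := measureReal_compl (μ := noiseLaw K n) hm
  rw [probReal_univ] at h1
  have h2 : {z | noiseless H (fun j => x j w) + z ∈ c.region w}ᶜ =
      ⋃ i, {z | c.dec i (received H (fun j => x j w) z i) ≠ w i} := by
    ext z
    simp only [Set.mem_compl_iff, Set.mem_ofPred_eq, Code.region, not_forall, Set.mem_iUnion]
    rfl
  have h3 : (noiseLaw K n).real (⋃ i, {z | c.dec i (received H (fun j => x j w) z i) ≠ w i}) ≤
      ∑ i, pairError c H x i w := measureReal_iUnion_fintype_le _
  rw [h2] at h1
  linarith

/-- The centres of the complete clusters of `2 * M + 1` users. -/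
def IsCenter (M K : ℕ) (i : Fin K) : Prop :=
  (i : ℕ) % (2 * M + 1) = M ∧ (i : ℕ) / (2 * M + 1) < K / (2 * M + 1)

theorem IsCenter.eq {M K : ℕ} {i : Fin K} (h : IsCenter M K i) :
    (i : ℕ) = (2 * M + 1) * ((i : ℕ) / (2 * M + 1)) + M := by
  have := Nat.div_add_mod (i : ℕ) (2 * M + 1)
  rw [h.1] at this
  exact this.symm

theorem IsCenter.lt {M K : ℕ} {i : Fin K} (h : IsCenter M K i) :
    (2 * M + 1) * ((i : ℕ) / (2 * M + 1)) + 2 * M < K := by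
  have h1 : (2 * M + 1) * ((i : ℕ) / (2 * M + 1) + 1) ≤ (2 * M + 1) * (K / (2 * M + 1)) :=
    Nat.mul_le_mul_left _ h.2
  have h2 := Nat.mul_div_le K (2 * M + 1)
  rw [Nat.mul_add] at h1
  omega

/-- A bound for the coefficients of a matrix that is not less than one. -/
noncomputable def gain {K : ℕ} (A : Matrix (Fin K) (Fin K) ℂ) : ℝ :=
  Real.exp (∑ i, ∑ j, Real.posLog ‖A i j‖)

theorem one_le_gain {K : ℕ} (A : Matrix (Fin K) (Fin K) ℂ) : 1 ≤ gain A :=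
  Real.one_le_exp (Finset.sum_nonneg fun _ _ => Finset.sum_nonneg fun _ _ => Real.posLog_nonneg)

theorem norm_le_gain {K : ℕ} (A : Matrix (Fin K) (Fin K) ℂ) (i j : Fin K) :
    ‖A i j‖ ≤ gain A := by
  have h1 : Real.posLog ‖A i j‖ ≤ ∑ i, ∑ j, Real.posLog ‖A i j‖ :=
    (Finset.single_le_sum (f := fun j => Real.posLog ‖A i j‖)
      (fun _ _ => Real.posLog_nonneg) (Finset.mem_univ j)).trans
    (Finset.single_le_sum (f := fun i => ∑ j, Real.posLog ‖A i j‖)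
      (fun _ _ => Finset.sum_nonneg fun _ _ => Real.posLog_nonneg) (Finset.mem_univ i))
  -- the logarithm has a junk value at zero
  rcases (norm_nonneg (A i j)).eq_or_lt with h | h
  · rw [← h]; exact (Real.exp_pos _).le
  · exact (Real.le_exp_log _).trans (Real.exp_le_exp.2 ((le_max_right _ _).trans h1))

/-- The bound from `norm_sub_predict_le` for the prediction error relative to the noise. -/
noncomputable def errorFactor (M : ℕ) (δ : ℝ) : ℝ := 1 + 2 * (δ⁻¹ * (M * (δ⁻¹ ^ 2) ^ M))

open Classical in
/-- The weight of the received signal `i` in the volume bound: a constant where the signal is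
predicted, and of the order of `1 / P` otherwise. -/
noncomputable def weight (M : ℕ) (δ P : ℝ) {K : ℕ} (A : Matrix (Fin K) (Fin K) ℂ)
    (i : Fin K) : ℝ :=
  if IsCenter M K i ∧ GoodSlot δ A then (2 * (K + 1) ^ 2 * errorFactor M δ ^ 2)⁻¹
  else (4 * P * gain A ^ 2)⁻¹

theorem one_le_errorFactor (M : ℕ) {δ : ℝ} (hδ : 0 < δ) : 1 ≤ errorFactor M δ := by
  unfold errorFactor
  have : 0 ≤ 2 * (δ⁻¹ * (M * (δ⁻¹ ^ 2) ^ M)) := by positivity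
  linarith

theorem weight_pos (M : ℕ) {δ P : ℝ} (hδ : 0 < δ) (hP : 0 < P) {K : ℕ}
    (A : Matrix (Fin K) (Fin K) ℂ) (i : Fin K) : 0 < weight M δ P A i := by
  have h1 := one_le_errorFactor M hδ
  have h2 := one_le_gain A
  unfold weight
  split_ifs <;> positivity

theorem sq_sum_norm_le {K : ℕ} (z : Fin K → ℂ) : (∑ i, ‖z i‖) ^ 2 ≤ K * ∑ i, ‖z i‖ ^ 2 := by
  have := sq_sum_le_card_mul_sum_sq (s := Finset.univ) (f := fun i => ‖z i‖)
  simpa using this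

/-- The estimate of the exponents in one time slot. -/
theorem sum_weight_mul_le {K M : ℕ} {δ P : ℝ} (hδ : 0 < δ) (hP : 1 ≤ P)
    (A : Matrix (Fin K) (Fin K) ℂ) (x y k : Fin K → ℂ)
    (hk : ∀ i, IsCenter M K i → GoodSlot δ A →
      ‖y i - k i‖ ≤ errorFactor M δ * ∑ j, ‖y j - ∑ l, A j l * x l‖)
    (hk0 : ∀ i, ¬ (IsCenter M K i ∧ GoodSlot δ A) → k i = 0) :
    ∑ i, weight M δ P A i * ‖y i - k i‖ ^ 2 ≤
      ∑ i, ‖y i - ∑ l, A i l * x l‖ ^ 2 + K ^ 2 / P * ∑ j, ‖x j‖ ^ 2 := by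
  have hE := one_le_errorFactor M hδ
  have hG := one_le_gain A
  set m : Fin K → ℂ := fun i => ∑ l, A i l * x l with hm
  set Z := ∑ i, ‖y i - m i‖ ^ 2 with hZ
  set X := ∑ j, ‖x j‖ ^ 2 with hX
  have hZ0 : 0 ≤ Z := Finset.sum_nonneg fun _ _ => by positivity
  have hX0 : 0 ≤ X := Finset.sum_nonneg fun _ _ => by positivity
  have hmX : ∀ i, ‖m i‖ ^ 2 ≤ gain A ^ 2 * (K * X) := by
    intro i
    have h1 : ‖m i‖ ≤ gain A * ∑ j, ‖x j‖ := by
      rw [Finset.mul_sum]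
      refine (norm_sum_le _ _).trans (Finset.sum_le_sum fun j _ => ?_)
      rw [norm_mul]
      exact mul_le_mul_of_nonneg_right (norm_le_gain A i j) (norm_nonneg _)
    calc ‖m i‖ ^ 2 ≤ (gain A * ∑ j, ‖x j‖) ^ 2 := pow_le_pow_left₀ (norm_nonneg _) h1 2
      _ = gain A ^ 2 * (∑ j, ‖x j‖) ^ 2 := mul_pow _ _ _
      _ ≤ _ := mul_le_mul_of_nonneg_left (sq_sum_norm_le x) (by positivity)
  have hterm : ∀ i, weight M δ P A i * ‖y i - k i‖ ^ 2 ≤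
      1 / 2 * ‖y i - m i‖ ^ 2 + 1 / (2 * (K + 1)) * Z + K / P * X := by
    intro i
    by_cases h : IsCenter M K i ∧ GoodSlot δ A
    · have h1 : ‖y i - k i‖ ^ 2 ≤ errorFactor M δ ^ 2 * (K * Z) := by
        calc ‖y i - k i‖ ^ 2 ≤ (errorFactor M δ * ∑ j, ‖y j - m j‖) ^ 2 :=
              pow_le_pow_left₀ (norm_nonneg _) (hk i h.1 h.2) 2
          _ = errorFactor M δ ^ 2 * (∑ j, ‖y j - m j‖) ^ 2 := mul_pow _ _ _
          _ ≤ _ := mul_le_mul_of_nonneg_left (sq_sum_norm_le _) (by positivity)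
      have h2 : weight M δ P A i * ‖y i - k i‖ ^ 2 ≤ 1 / (2 * (K + 1)) * Z := by
        rw [weight, if_pos h, inv_mul_le_iff₀ (by positivity)]
        refine h1.trans ?_
        have : 2 * ((K : ℝ) + 1) ^ 2 * errorFactor M δ ^ 2 * (1 / (2 * (K + 1)) * Z) =
            errorFactor M δ ^ 2 * ((K + 1) * Z) := by
          field_simp
        rw [this]
        refine mul_le_mul_of_nonneg_left ?_ (by positivity)
        exact mul_le_mul_of_nonneg_right (by linarith) hZ0
      have h3 : 0 ≤ K / P * X := by positivity
      have h4 : 0 ≤ 1 / 2 * ‖y i - m i‖ ^ 2 := by positivity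
      linarith
    · rw [hk0 i h, sub_zero, weight, if_neg h, inv_mul_le_iff₀ (by positivity)]
      have h1 : ‖y i‖ ^ 2 ≤ 2 * ‖y i - m i‖ ^ 2 + 2 * ‖m i‖ ^ 2 := by
        have h2 : ‖y i‖ ≤ ‖y i - m i‖ + ‖m i‖ := by
          simpa using norm_add_le (y i - m i) (m i)
        calc ‖y i‖ ^ 2 ≤ (‖y i - m i‖ + ‖m i‖) ^ 2 := pow_le_pow_left₀ (norm_nonneg _) h2 2
          _ ≤ _ := by nlinarith [sq_nonneg (‖y i - m i‖ - ‖m i‖)]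
      have h3 : 1 ≤ P * gain A ^ 2 := one_le_mul_of_one_le_of_one_le hP (one_le_pow₀ hG)
      have h5 : 4 * P * gain A ^ 2 * (K / P * X) = 4 * (gain A ^ 2 * (K * X)) := by
        field_simp
      have h6 : 0 ≤ 1 / (2 * ((K : ℝ) + 1)) * Z := by positivity
      have h7 := mul_le_mul_of_nonneg_right h3 (show 0 ≤ 2 * ‖y i - m i‖ ^ 2 by positivity)
      have h8 : 0 ≤ 4 * P * gain A ^ 2 * (1 / (2 * ((K : ℝ) + 1)) * Z) := by positivity
      have h9 := hmX i
      have h10 : 0 ≤ gain A ^ 2 * (K * X) := by positivity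
      rw [mul_add, mul_add, h5]
      linarith
  calc _ ≤ ∑ i, (1 / 2 * ‖y i - m i‖ ^ 2 + 1 / (2 * (K + 1)) * Z + K / P * X) :=
        Finset.sum_le_sum fun i _ => hterm i
    _ = 1 / 2 * Z + K * (1 / (2 * (K + 1)) * Z) + K * (K / P * X) := by
        rw [Finset.sum_add_distrib, Finset.sum_add_distrib, ← Finset.mul_sum]
        simp [hZ]
    _ ≤ Z + K ^ 2 / P * X := by
        have h1 : (K : ℝ) * (1 / (2 * (K + 1)) * Z) ≤ 1 / 2 * Z := by
          rw [← mul_assoc]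
          refine mul_le_mul_of_nonneg_right ?_ hZ0
          rw [mul_one_div, div_le_div_iff₀ (by positivity) (by norm_num)]
          linarith
        have h2 : (K : ℝ) * (K / P * X) = K ^ 2 / P * X := by ring
        linarith

/-- The numbers of messages in a code with small error probabilities are bounded by the volume
that the received signals can fill. Given the messages of all users but the centres, the
received signals of these users determine those of the centres up to noise. -/
theorem prod_size_le {K n M : ℕ} {T : Fin K → Finset (Fin K)}
    (hT : ∀ i, (T i).card ≤ M) {P : ℝ} (hP : 1 ≤ P) (c : Code K n T P) (f : Fading)
    (g : ℕ × Fin K × Fin K → ℂ) (hc : ∀ i, 0 < c.size i)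
    (herr : ∑ i, c.errorProb (coeff 1 f g) i ≤ 1 / 2) {δ : ℝ} (hδ : 0 < δ) (hδ1 : δ ≤ 1) :
    ∏ i, (c.size i : ℝ) ≤ 2 * (Real.exp (n * K ^ 3) *
      ∏ i, ∏ t : Fin n, (weight M δ P (coeff 1 f g t) i)⁻¹) := by
  classical
  set H := coeff 1 f g with hH
  set N : ℝ := ∏ i, (c.size i : ℝ) with hN
  have hN0 : 0 < N := Finset.prod_pos fun i _ => by exact_mod_cast hc i
  have hcard : (Fintype.card (∀ i, Fin (c.size i)) : ℝ) = N := by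
    simp [hN, Fintype.card_pi]
  obtain ⟨x, hxP, hxloc, hxerr⟩ := exists_local_signals hT c f g
  let w₀ : ∀ i, Fin (c.size i) := fun i => ⟨0, hc i⟩
  -- the messages of the users other than the centres, read off from the received signals, with
  -- an arbitrary entry for the centres
  let guess : (Fin K → Fin n → ℂ) → ∀ i, Fin (c.size i) := fun y i =>
    if IsCenter M K i then w₀ i else c.dec i (y i)
  have hguess : Measurable guess := by
    refine measurable_pi_lambda _ fun i => ?_
    by_cases h : IsCenter M K i
    · simp only [guess, h, if_true]; exact measurable_const
    · simp only [guess, h, if_false]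
      exact (c.measurable_dec i).comp (measurable_pi_apply i)
  let off : Fin K → ℕ := fun i => (2 * M + 1) * ((i : ℕ) / (2 * M + 1))
  let k : (Fin K → Fin n → ℂ) → Fin K → Fin n → ℂ := fun y i t =>
    if IsCenter M K i ∧ GoodSlot δ (H t) then
      predict M (H t) (off i) (extend fun j => y j t) (shifted (fun j => x j (guess y) t) (off i))
        (shifted (fun j => x j (guess y) t) (off i + 2 * M + 1))
    else 0
  have hkm : Measurable k := by
    refine measurable_pi_lambda _ fun i => measurable_pi_lambda _ fun t => ?_
    by_cases h : IsCenter M K i ∧ GoodSlot δ (H t)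
    · simp only [k, h, and_self, if_true]
      have hx : ∀ m, Measurable fun y => shifted (fun j => x j (guess y) t) m := fun m =>
        (measurable_of_countable fun w => shifted (fun j => x j w t) m).comp hguess
      refine measurable_predict (fun s => ?_) (hx _) (hx _)
      by_cases hs : s < K
      · simp only [extend, hs, dite_true]
        fun_prop
      · simp only [extend, hs, dite_false]
        exact measurable_const
    · simp only [k, h, if_false]; exact measurable_const
  have hkB : ∀ y y', (∀ i ∉ {i | IsCenter M K i}, y i = y' i) → k y = k y' := by
    intro y y' hy
    have hg : guess y = guess y' := by
      funext i
      by_cases h : IsCenter M K i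
      · simp [guess, h]
      · simp [guess, h, hy i h]
    funext i t
    by_cases h : IsCenter M K i ∧ GoodSlot δ (H t)
    · simp only [k, h, and_self, if_true, hg]
      refine predict_congr fun s hs hsM => ?_
      by_cases hlt : off i + s < K
      · simp only [extend, hlt, dite_true]
        rw [hy]
        rintro ⟨hmod, -⟩
        simp only [off, Nat.mul_add_mod] at hmod
        rw [Nat.mod_eq_of_lt (by omega)] at hmod
        exact hsM hmod
      · simp [extend, hlt]
    · simp only [k, h, if_false]
  have hk0 : ∀ y, ∀ i ∉ {i | IsCenter M K i}, k y i = 0 := by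
    intro y i hi
    funext t
    have : ¬ IsCenter M K i := hi
    simp [k, this]
  -- the boundary transmitters do not use the messages of the centres
  have hbdry : ∀ w y, y ∈ c.region w → ∀ (t : Fin n) (q : ℕ),
      shifted (fun j => x j (guess y) t) ((2 * M + 1) * q) =
        shifted (fun j => x j w t) ((2 * M + 1) * q) := by
    intro w y hy t q
    rcases hj : (2 * M + 1) * q with _ | j
    · rfl
    · simp only [shifted, extend]
      split_ifs with hjK
      · rw [hxloc ⟨j, hjK⟩ (guess y) w fun i hi1 hi2 => ?_]
        by_cases h : IsCenter M K i
        · exfalso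
          have h1 := h.eq
          simp only at hi1 hi2
          set q' := (i : ℕ) / (2 * M + 1)
          rcases Nat.lt_or_ge q' q with hq | hq
          · have := Nat.mul_le_mul_left (2 * M + 1) hq
            rw [Nat.succ_eq_add_one, Nat.mul_add] at this
            omega
          · have := Nat.mul_le_mul_left (2 * M + 1) hq
            omega
        · simpa [guess, h] using hy i
      · rfl
  have hmain := sum_noiseLaw_le (fun w => noiseless H fun j => x j w) c.region
    c.measurableSet_region (by
      intro w w' hww'
      refine Set.disjoint_left.2 fun y hy hy' => hww' ?_
      funext i
      exact (hy i).symm.trans (hy' i)) {i | IsCenter M K i} k hkm hkB hk0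
    (fun i t => weight M δ P (H t) i) (fun i t => weight_pos M hδ (by linarith) _ _)
    (n * K ^ 3) (by
      intro w y hy
      rw [Finset.sum_comm]
      have hslot : ∀ t : Fin n, ∑ i, weight M δ P (H t) i * ‖y i t - k y i t‖ ^ 2 ≤
          ∑ i, ‖y i t - noiseless H (fun j => x j w) i t‖ ^ 2 +
            K ^ 2 / P * ∑ j, ‖x j w t‖ ^ 2 := by
        intro t
        refine sum_weight_mul_le hδ hP (H t) (fun j => x j w t) (fun i => y i t)
          (fun i => k y i t) (fun i hi hg => ?_) (fun i hi => by simp [k, hi])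
        have hi' := hi.eq
        have hlt := hi.lt
        have hb0 := hbdry w y hy t ((i : ℕ) / (2 * M + 1))
        have hb1 := hbdry w y hy t ((i : ℕ) / (2 * M + 1) + 1)
        have e : (2 * M + 1) * ((i : ℕ) / (2 * M + 1) + 1) = off i + 2 * M + 1 := by
          simp only [off]; ring
        rw [e] at hb1
        simp only [k, hi, hg, and_self, if_true]
        rw [hb1, show off i = (2 * M + 1) * ((i : ℕ) / (2 * M + 1)) from rfl, hb0]
        have := norm_sub_predict_le hδ hδ1 hg hlt (ξ := shifted fun j => x j w t)
          (σ := extend fun j => y j t)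
          (z := extend fun i => y i t - noiseless H (fun j => x j w) i t)
          (S := ∑ j, ‖y j t - noiseless H (fun j => x j w) j t‖) ?_ ?_
        · rw [← hi', extend_val] at this
          exact this
        · intro j hj
          have := sum_coeff_mul f g t (fun j => x j w t) ⟨j, hj⟩
          simp only at this
          rw [← hH] at this
          simp only [extend, hj, dite_true, noiseless]
          rw [← this]
          ring
        · intro j hj
          simp only [extend, hj, dite_true]
          exact Finset.single_le_sum
            (f := fun j => ‖y j t - noiseless H (fun j => x j w) j t‖)
            (fun _ _ => norm_nonneg _) (Finset.mem_univ _)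
      refine (Finset.sum_le_sum fun t _ => hslot t).trans ?_
      rw [Finset.sum_add_distrib, Finset.sum_comm]
      refine add_le_add le_rfl ?_
      rw [← Finset.mul_sum, Finset.sum_comm]
      calc (K : ℝ) ^ 2 / P * ∑ j, ∑ t, ‖x j w t‖ ^ 2 ≤ K ^ 2 / P * ∑ _j : Fin K, n * P :=
            mul_le_mul_of_nonneg_left (Finset.sum_le_sum fun j _ => hxP j w) (by positivity)
        _ = n * K ^ 3 := by
            have : P ≠ 0 := by positivity
            simp
            field_simp)
  have hreal : ∑ w, (noiseLaw K n).real {z | noiseless H (fun j => x j w) + z ∈ c.region w} ≤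
      Real.exp (n * K ^ 3) * ∏ i, ∏ t : Fin n, (weight M δ P (H t) i)⁻¹ := by
    have h1 := ENNReal.toReal_mono ENNReal.ofReal_ne_top hmain
    rw [ENNReal.toReal_sum fun w _ => measure_ne_top _ _, ENNReal.toReal_ofReal] at h1
    · exact h1
    · exact mul_nonneg (Real.exp_pos _).le (Finset.prod_nonneg fun i _ =>
        Finset.prod_nonneg fun t _ => (inv_pos.2 (weight_pos M hδ (by linarith) _ _)).le)
  have hone := Finset.sum_le_sum fun w (_ : w ∈ Finset.univ) =>
    one_sub_sum_pairError_le c H x w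
  rw [Finset.sum_sub_distrib] at hone
  simp only [Finset.sum_const, Finset.card_univ, nsmul_eq_mul, mul_one, hcard] at hone
  have herr' : ∑ w, ∑ i, pairError c H c.enc i w ≤ N / 2 := by
    rw [Finset.sum_comm]
    have : ∀ i, c.errorProb H i = (∑ w, pairError c H c.enc i w) / N := fun i => rfl
    simp only [this, ← Finset.sum_div] at herr
    rw [div_le_iff₀ hN0] at herr
    linarith
  linarith

/-! ### The converse -/

open Classical in
/-- The properties of a typical channel realization that the coding arguments use: the
coefficients are rarely close to zero or large, and their positive logarithms have bounded
averages. -/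
def Regular {K : ℕ} (H : ℕ → Matrix (Fin K) (Fin K) ℂ) : Prop :=
  (∀ θ : ℝ, 0 < θ → ∃ δ : ℝ, 0 < δ ∧ δ ≤ 1 ∧ ∀ᶠ n : ℕ in atTop,
    (((Finset.range n).filter fun t => ¬ GoodSlot δ (H t)).card : ℝ) ≤ θ * n) ∧
  ∃ C : ℝ, ∀ᶠ n : ℕ in atTop,
    ∑ t ∈ Finset.range n, ∑ i, ∑ j, Real.posLog ‖H t i j‖ ≤ C * n

open Classical in
theorem div_le_card_isCenter (M K : ℕ) :
    K / (2 * M + 1) ≤ (Finset.univ.filter fun i => IsCenter M K i).card := by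
  have hlt : ∀ q : Fin (K / (2 * M + 1)), (2 * M + 1) * (q : ℕ) + M < K := by
    intro q
    have h1 := Nat.mul_le_mul_left (2 * M + 1) q.2
    have h2 := Nat.mul_div_le K (2 * M + 1)
    rw [Nat.succ_eq_add_one, Nat.mul_add] at h1
    omega
  have h := Finset.card_le_card_of_injOn (s := (Finset.univ : Finset (Fin (K / (2 * M + 1)))))
    (t := Finset.univ.filter fun i => IsCenter M K i)
    (fun q => ⟨(2 * M + 1) * (q : ℕ) + M, hlt q⟩) (fun q _ => ?_) (fun q _ q' _ h => ?_)
  · simpa using h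
  · have h1 : ((2 * M + 1) * (q : ℕ) + M) % (2 * M + 1) = M := by
      rw [Nat.mul_add_mod, Nat.mod_eq_of_lt (by omega)]
    have h2 : ((2 * M + 1) * (q : ℕ) + M) / (2 * M + 1) = q := by
      have h3 : M / (2 * M + 1) = 0 := Nat.div_eq_of_lt (by omega)
      rw [Nat.mul_add_div (by omega), h3, add_zero]
    exact Finset.mem_coe.2 (Finset.mem_filter.2
      ⟨Finset.mem_univ _, h1, h2.trans_lt q.2⟩)
  · simp only [Fin.mk.injEq, add_left_inj] at h
    exact Fin.ext (Nat.eq_of_mul_eq_mul_left (by omega) h)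

open Classical in
theorem log_inv_weight_le {M K : ℕ} {δ P : ℝ} (hδ : 0 < δ) (hP : 1 ≤ P)
    (A : Matrix (Fin K) (Fin K) ℂ) (i : Fin K) :
    Real.log (weight M δ P A i)⁻¹ ≤ Real.log (4 + 2 * (K + 1) ^ 2 * errorFactor M δ ^ 2) +
      2 * ∑ i, ∑ j, Real.posLog ‖A i j‖ +
      if IsCenter M K i ∧ GoodSlot δ A then 0 else Real.log P := by
  have hE := one_le_errorFactor M hδ
  have hG := one_le_gain A
  have h0 : 0 ≤ 2 * ((K : ℝ) + 1) ^ 2 * errorFactor M δ ^ 2 := by positivity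
  have hlog : Real.log (gain A) = ∑ i, ∑ j, Real.posLog ‖A i j‖ := Real.log_exp _
  unfold weight
  split_ifs with h
  · rw [inv_inv, ← hlog]
    have h1 : Real.log (2 * (K + 1) ^ 2 * errorFactor M δ ^ 2) ≤
        Real.log (4 + 2 * (K + 1) ^ 2 * errorFactor M δ ^ 2) :=
      Real.log_le_log (by positivity) (by linarith)
    have h2 := Real.log_nonneg hG
    linarith
  · rw [inv_inv, Real.log_mul (by positivity) (by positivity),
      Real.log_mul (by norm_num) (by positivity), Real.log_pow, hlog]
    have h1 : Real.log 4 ≤ Real.log (4 + 2 * (K + 1) ^ 2 * errorFactor M δ ^ 2) :=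
      Real.log_le_log (by norm_num) (by linarith)
    push_cast
    linarith

open Classical in
/-- The prelogarithmic factor: only the users that are not centres contribute in good slots. -/
theorem sum_log_inv_weight_le {M K : ℕ} {δ P : ℝ} (hδ : 0 < δ) (hP : 1 ≤ P)
    (H : ℕ → Matrix (Fin K) (Fin K) ℂ) (n : ℕ) :
    ∑ i, ∑ t : Fin n, Real.log (weight M δ P (H t) i)⁻¹ ≤
      n * (K * Real.log (4 + 2 * (K + 1) ^ 2 * errorFactor M δ ^ 2)) +
      2 * K * ∑ t ∈ Finset.range n, ∑ i, ∑ j, Real.posLog ‖H t i j‖ +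
      (n * (K - (K / (2 * M + 1) : ℕ)) +
        K * ((Finset.range n).filter fun t => ¬ GoodSlot δ (H t)).card) * Real.log P := by
  have hlogP := Real.log_nonneg hP
  have hcen : (((K / (2 * M + 1) : ℕ)) : ℝ) ≤
      (Finset.univ.filter fun i => IsCenter M K i).card := by
    exact_mod_cast div_le_card_isCenter M K
  have hslot : ∀ t : ℕ, ∑ i, Real.log (weight M δ P (H t) i)⁻¹ ≤
      K * Real.log (4 + 2 * (K + 1) ^ 2 * errorFactor M δ ^ 2) +
      2 * K * ∑ i, ∑ j, Real.posLog ‖H t i j‖ +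
      (K - (K / (2 * M + 1) : ℕ) + K * if ¬ GoodSlot δ (H t) then 1 else 0) * Real.log P := by
    intro t
    refine (Finset.sum_le_sum fun i _ => log_inv_weight_le hδ hP (H t) i).trans ?_
    rw [Finset.sum_add_distrib, Finset.sum_const, Finset.card_univ, Fintype.card_fin,
      nsmul_eq_mul]
    have h1 : (∑ i, if IsCenter M K i ∧ GoodSlot δ (H t) then 0 else Real.log P) ≤
        (K - (K / (2 * M + 1) : ℕ) + K * if ¬ GoodSlot δ (H t) then 1 else 0) *
          Real.log P := by
      by_cases hg : GoodSlot δ (H t)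
      · have h2 := Finset.card_filter_add_card_filter_not (s := Finset.univ)
          (fun i : Fin K => IsCenter M K i)
        have h3 : (((Finset.univ.filter fun i => IsCenter M K i).card : ℝ) +
            ((Finset.univ.filter fun i => ¬ IsCenter M K i).card : ℝ)) = K := by
          rw [Finset.card_univ, Fintype.card_fin] at h2
          exact_mod_cast h2
        simp only [hg, and_true, not_true_eq_false, if_false, mul_zero, add_zero]
        rw [Finset.sum_ite, Finset.sum_const_zero, zero_add, Finset.sum_const, nsmul_eq_mul]
        exact mul_le_mul_of_nonneg_right (by linarith) hlogP
      · simp only [hg, and_false, if_false, not_false_eq_true, if_true, mul_one,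
          Finset.sum_const, Finset.card_univ, Fintype.card_fin, nsmul_eq_mul]
        refine mul_le_mul_of_nonneg_right ?_ hlogP
        have : (((K / (2 * M + 1) : ℕ)) : ℝ) ≤ K := by exact_mod_cast Nat.div_le_self _ _
        linarith
    linarith
  rw [Finset.sum_comm]
  refine (Finset.sum_le_sum fun (t : Fin n) _ => hslot t).trans (le_of_eq ?_)
  rw [Fin.sum_univ_eq_sum_range (fun t => K * Real.log (4 + 2 * (K + 1) ^ 2 *
      errorFactor M δ ^ 2) + 2 * K * ∑ i, ∑ j, Real.posLog ‖H t i j‖ +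
      (K - (K / (2 * M + 1) : ℕ) + K * if ¬ GoodSlot δ (H t) then 1 else 0) * Real.log P),
    Finset.sum_add_distrib, Finset.sum_add_distrib, Finset.sum_const, Finset.card_range,
    nsmul_eq_mul, ← Finset.mul_sum, ← Finset.sum_mul, Finset.sum_add_distrib, Finset.sum_const,
    Finset.card_range, nsmul_eq_mul, ← Finset.mul_sum, Finset.sum_boole]

/-- On a typical channel the rates are bounded by `K - ⌊K / (2 M + 1)⌋ + θ` times `log P`, up to a
constant. -/
theorem exists_sum_rate_le {K M : ℕ} {T : Fin K → Finset (Fin K)} (hT : ∀ i, (T i).card ≤ M)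
    (f : Fading) (g : ℕ × Fin K × Fin K → ℂ) (hreg : Regular (coeff 1 f g)) {θ : ℝ}
    (hθ : 0 < θ) :
    ∃ C : ℝ, ∀ P R, 1 ≤ P → RateAchievable T (coeff 1 f g) P R →
      ∑ i, R i ≤ C + ((K - (K / (2 * M + 1) : ℕ)) + K * θ) * Real.log P := by
  classical
  obtain ⟨δ, hδ, hδ1, hbad⟩ := hreg.1 θ hθ
  obtain ⟨G, hG⟩ := hreg.2
  -- error probabilities of at most `1 / (2 * (K + 1))` add up to at most `1 / 2`
  refine ⟨Real.log 2 + K ^ 3 + K * Real.log (4 + 2 * (K + 1) ^ 2 * errorFactor M δ ^ 2) +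
    2 * K * G, fun P R hP hR => ?_⟩
  have hlogP := Real.log_nonneg hP
  obtain ⟨N, hN⟩ := hR.2 (1 / (2 * (K + 1))) (by positivity)
  obtain ⟨n, ⟨hbadn, hGn⟩, hnN⟩ :=
    ((hbad.and hG).and (eventually_ge_atTop (max N 1))).exists
  obtain ⟨c, hsize, herr⟩ := hN n ((le_max_left _ _).trans hnN)
  have hn1 : (1 : ℝ) ≤ n := by exact_mod_cast (le_max_right N 1).trans hnN
  have hpos : ∀ i, (0 : ℝ) < c.size i := fun i => (Real.exp_pos _).trans_le (hsize i)
  have herr' : ∑ i, c.errorProb (coeff 1 f g) i ≤ 1 / 2 := by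
    refine (Finset.sum_le_sum fun i _ => herr i).trans ?_
    rw [Finset.sum_const, Finset.card_univ, Fintype.card_fin, nsmul_eq_mul, mul_one_div,
      div_le_div_iff₀ (by positivity) (by norm_num)]
    linarith
  have hmain := prod_size_le hT hP c f g (fun i => by exact_mod_cast hpos i) herr' hδ hδ1
  have hw : ∀ i (t : Fin n), 0 < (weight M δ P (coeff 1 f g t) i)⁻¹ := fun i t =>
    inv_pos.2 (weight_pos M hδ (by linarith) _ _)
  have hprod : 0 < ∏ i, ∏ t : Fin n, (weight M δ P (coeff 1 f g t) i)⁻¹ :=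
    Finset.prod_pos fun i _ => Finset.prod_pos fun t _ => hw i t
  have hlog := Real.log_le_log (Finset.prod_pos fun i _ => hpos i) hmain
  rw [Real.log_mul (by norm_num) (by positivity), Real.log_mul (by positivity) hprod.ne',
    Real.log_exp, Real.log_prod fun i _ => (hpos i).ne',
    Real.log_prod fun i _ => (Finset.prod_pos fun t _ => hw i t).ne'] at hlog
  simp only [Real.log_prod fun (t : Fin n) (_ : t ∈ Finset.univ) => (hw _ t).ne'] at hlog
  have hrate : n * ∑ i, R i ≤ ∑ i, Real.log (c.size i) := by
    rw [Finset.mul_sum]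
    refine Finset.sum_le_sum fun i _ => ?_
    rw [Real.le_log_iff_exp_le (hpos i)]
    exact hsize i
  have hsum := sum_log_inv_weight_le (M := M) hδ hP (coeff 1 f g) n
  have h1 : (K : ℝ) * (((Finset.range n).filter
      fun t => ¬ GoodSlot δ (coeff 1 f g t)).card : ℝ) * Real.log P ≤
      K * (θ * n) * Real.log P :=
    mul_le_mul_of_nonneg_right (mul_le_mul_of_nonneg_left hbadn (by positivity)) hlogP
  have h2 : 2 * (K : ℝ) * ∑ t ∈ Finset.range n, ∑ i, ∑ j, Real.posLog ‖coeff 1 f g t i j‖ ≤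
      2 * K * (G * n) := mul_le_mul_of_nonneg_left hGn (by positivity)
  have h3 : Real.log 2 ≤ n * Real.log 2 :=
    le_mul_of_one_le_left (Real.log_nonneg (by norm_num)) hn1
  have hfin : n * ∑ i, R i ≤ n * (Real.log 2 + K ^ 3 +
      K * Real.log (4 + 2 * (K + 1) ^ 2 * errorFactor M δ ^ 2) + 2 * K * G +
      ((K - (K / (2 * M + 1) : ℕ)) + K * θ) * Real.log P) := by
    linarith
  exact le_of_mul_le_mul_left hfin (by linarith)

/-- Every complete cluster costs one degree of freedom. -/
theorem sum_dof_le {K M : ℕ} {T : Fin K → Finset (Fin K)} (hT : ∀ i, (T i).card ≤ M)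
    (f : Fading) (g : ℕ × Fin K × Fin K → ℂ) (hreg : Regular (coeff 1 f g)) {d : Fin K → ℝ}
    (hd : DoFAchievable T (coeff 1 f g) d) : ∑ i, d i ≤ K - (K / (2 * M + 1) : ℕ) := by
  obtain ⟨R, hR, hlim⟩ := hd
  have hθ : ∀ θ : ℝ, 0 < θ → ∑ i, d i ≤ (K - (K / (2 * M + 1) : ℕ)) + K * θ := by
    intro θ hθ
    obtain ⟨C, hC⟩ := exists_sum_rate_le hT f g hreg hθ
    have h1 : Tendsto (fun P => ∑ i, R P i / Real.log P) atTop (𝓝 (∑ i, d i)) :=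
      tendsto_finsetSum _ fun i _ => hlim i
    have h2 : Tendsto (fun P => C / Real.log P + ((K - (K / (2 * M + 1) : ℕ)) + K * θ)) atTop
        (𝓝 (0 + ((K - (K / (2 * M + 1) : ℕ)) + K * θ))) :=
      (Real.tendsto_log_atTop.const_div_atTop C).add_const _
    rw [zero_add] at h2
    refine le_of_tendsto_of_tendsto h1 h2 ?_
    filter_upwards [eventually_gt_atTop (1 : ℝ)] with P hP
    have hlog := Real.log_pos hP
    rw [← Finset.sum_div, div_add' _ _ _ hlog.ne']
    exact div_le_div_of_nonneg_right (hC P (R P) hP.le (hR P (by linarith))) hlog.le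
  refine le_of_forall_pos_le_add fun ε hε => (hθ (ε / (K + 1)) (by positivity)).trans ?_
  have : (K : ℝ) * (ε / (K + 1)) ≤ ε := by
    rw [mul_div_assoc', div_le_iff₀ (by positivity)]
    linarith
  linarith

theorem dof_nonneg {K : ℕ} {T : Fin K → Finset (Fin K)} {H : ℕ → Matrix (Fin K) (Fin K) ℂ}
    {d : Fin K → ℝ} (hd : DoFAchievable T H d) (i : Fin K) : 0 ≤ d i := by
  obtain ⟨R, hR, hlim⟩ := hd
  refine ge_of_tendsto (hlim i) ?_
  filter_upwards [eventually_gt_atTop (1 : ℝ)] with P hP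
  exact div_nonneg ((hR P (by linarith)).1 i) (Real.log_pos hP).le

/-! ### Typical channel realizations -/

theorem eventually_bounds_of_ne_zero {h : ℂ} (hh : h ≠ 0) :
    ∀ᶠ δ : ℝ in 𝓝[>] 0, δ ≤ ‖h‖ ∧ ‖h‖ ≤ δ⁻¹ := by
  have h0 : 0 < ‖h‖ := norm_pos_iff.2 hh
  have h1 : ∀ᶠ δ : ℝ in 𝓝[>] 0, δ ≤ ‖h‖ :=
    (eventually_le_nhds h0).filter_mono nhdsWithin_le_nhds
  exact h1.and (tendsto_inv_nhdsGT_zero.eventually_ge_atTop _)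

/-- The coefficients that are not allowed in a `δ`-good slot. -/
def extremeSet (δ : ℝ) : Set ℂ := {h | ¬ (δ ≤ ‖h‖ ∧ ‖h‖ ≤ δ⁻¹)}

theorem measurableSet_extremeSet (δ : ℝ) : MeasurableSet (extremeSet δ) :=
  ((measurableSet_le measurable_const measurable_norm).inter
    (measurableSet_le measurable_norm measurable_const)).compl

/-- As the law has no atom at zero, coefficients outside `[δ, δ⁻¹]` become rare as `δ → 0`. -/
theorem tendsto_measure_extremeSet (μ : Measure ℂ) [IsProbabilityMeasure μ] [NullSingletonClass μ] :
    Tendsto (fun m : ℕ => ∫ h, Set.indicator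
      (extremeSet ((m : ℝ) + 1)⁻¹) (fun _ => (1 : ℝ)) h ∂μ)
      atTop (𝓝 0) := by
  have h0 : (0 : ℝ) = ∫ _h, (0 : ℝ) ∂μ := by simp
  rw [h0]
  refine tendsto_integral_of_dominated_convergence (fun _ => 1) (fun m => ?_)
    (integrable_const _) (fun m => ae_of_all _ fun h => ?_) ?_
  · exact (measurable_const.indicator (measurableSet_extremeSet _)).aestronglyMeasurable
  · refine (norm_indicator_le_norm_self _ _).trans ?_
    simp
  · filter_upwards [Measure.ae_ne μ 0] with h hh
    have ht : Tendsto (fun m : ℕ => ((m : ℝ) + 1)⁻¹) atTop (𝓝[>] 0) := by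
      refine tendsto_nhdsWithin_iff.2 ⟨?_, Eventually.of_forall fun m => ?_⟩
      · simpa using tendsto_one_div_add_atTop_nhds_zero_nat (𝕜 := ℝ)
      · exact Set.mem_Ioi.2 (by positivity)
    refine tendsto_const_nhds.congr' ?_
    filter_upwards [ht.eventually (eventually_bounds_of_ne_zero hh)] with m hm
    rw [Set.indicator_of_notMem]
    exact not_not.2 hm

/-- The strong law of large numbers for one channel coefficient of a time-varying channel. -/
theorem ae_tendsto_average (μ : Measure ℂ) [IsProbabilityMeasure μ] {K : ℕ} (i j : Fin K)
    {F : ℂ → ℝ} (hF : Measurable F) (hint : Integrable F μ) :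
    ∀ᵐ g ∂(drawLaw μ K),
      Tendsto (fun n : ℕ => (∑ t ∈ Finset.range n, F (g (t, i, j))) / n) atTop
        (𝓝 (∫ h, F h ∂μ)) := by
  have hmp : ∀ k : ℕ × Fin K × Fin K, MeasurePreserving (fun g => g k) (drawLaw μ K) μ :=
    fun k => measurePreserving_eval_infinitePi (fun _ => μ) k
  have hind := iIndepFun_infinitePi (P := fun _ : ℕ × Fin K × Fin K => μ)
    (X := fun _ h => F h) (fun _ => hF)
  have hint0 : Integrable (fun g : ℕ × Fin K × Fin K → ℂ => F (g (0, i, j))) (drawLaw μ K) :=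
    ((hmp (0, i, j)).integrable_comp hint.aestronglyMeasurable).2 hint
  have h := strong_law_ae_real (μ := drawLaw μ K) (fun t g => F (g (t, i, j))) hint0
    (fun s t hst => hind.indepFun (i := (s, i, j)) (j := (t, i, j)) (by simpa using hst))
    (fun t => by
      have hm : ∀ k, Measurable fun g : ℕ × Fin K × Fin K → ℂ => F (g k) :=
        fun k => hF.comp (measurable_pi_apply k)
      refine ⟨(hm _).aemeasurable, (hm _).aemeasurable, ?_⟩
      have he : ∀ k, Measure.map (fun g : ℕ × Fin K × Fin K → ℂ => F (g k)) (drawLaw μ K) =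
          Measure.map F μ := fun k => by
        have := Measure.map_map (μ := drawLaw μ K) hF (hmp k).measurable
        rw [(hmp k).map_eq] at this
        exact this.symm
      rw [he, he])
  have hE : ∫ g, F (g (0, i, j)) ∂(drawLaw μ K) = ∫ h, F h ∂μ := by
    have := integral_map (μ := drawLaw μ K) (hmp (0, i, j)).measurable.aemeasurable
      (f := F) hF.aestronglyMeasurable
    rw [(hmp (0, i, j)).map_eq] at this
    exact this.symm
  rw [← hE]
  exact h

theorem regular_static {K : ℕ} {g : ℕ × Fin K × Fin K → ℂ} (hg : ∀ i j, g (0, i, j) ≠ 0) :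
    Regular (coeff 1 .static g) := by
  classical
  have hH : ∀ t, coeff 1 .static g t = coeff 1 .static g 0 := fun t => rfl
  have h1 : ∀ᶠ δ : ℝ in 𝓝[>] 0, GoodSlot δ (coeff 1 .static g 0) := by
    refine eventually_all.2 fun i => eventually_all.2 fun j => ?_
    filter_upwards [eventually_bounds_of_ne_zero (hg i j)] with δ hδ hij
    simpa [coeff, hij, Fading.draw] using hδ
  have h2 : ∀ᶠ δ : ℝ in 𝓝[>] 0, δ ≤ 1 :=
    (eventually_le_nhds one_pos).filter_mono nhdsWithin_le_nhds
  have h3 : ∀ᶠ δ : ℝ in 𝓝[>] 0, 0 < δ := eventually_mem_nhdsWithin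
  obtain ⟨δ, ⟨hgood, hδ1⟩, hδ⟩ := ((h1.and h2).and h3).exists
  refine ⟨fun θ hθ => ⟨δ, hδ, hδ1, Eventually.of_forall fun n => ?_⟩,
    ∑ i, ∑ j, Real.posLog ‖coeff 1 .static g 0 i j‖, Eventually.of_forall fun n => ?_⟩
  · rw [Finset.filter_false_of_mem fun t _ => not_not.2 (hH t ▸ hgood)]
    simp only [Finset.card_empty, Nat.cast_zero]
    positivity
  · simp only [hH]
    rw [Finset.sum_const, Finset.card_range, nsmul_eq_mul, mul_comm]

/-- A time-varying channel is regular if the averages along each coefficient converge as the law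
of large numbers predicts. A slot is bad only if one of its `K * K` coefficients is. -/
theorem regular_timeVarying {K : ℕ} {g : ℕ × Fin K × Fin K → ℂ} {p : ℕ → ℝ} {C : ℝ}
    (hp : Tendsto p atTop (𝓝 0))
    (h1 : ∀ (m : ℕ) (i j : Fin K), Tendsto (fun n : ℕ => (∑ t ∈ Finset.range n, Set.indicator
      (extremeSet ((m : ℝ) + 1)⁻¹) (fun _ => (1 : ℝ))
        (g (t, i, j))) / n) atTop (𝓝 (p m)))
    (h2 : ∀ i j : Fin K, Tendsto (fun n : ℕ =>
      (∑ t ∈ Finset.range n, Real.posLog ‖g (t, i, j)‖) / n) atTop (𝓝 C)) :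
    Regular (coeff 1 .timeVarying g) := by
  classical
  refine ⟨fun θ hθ => ?_, K * (K * (C + 1)), ?_⟩
  · obtain ⟨m, hm⟩ := (hp.eventually_lt_const
      (show 0 < θ / (K * K + 1) by positivity)).exists
    refine ⟨((m : ℝ) + 1)⁻¹, by positivity,
      inv_le_one_of_one_le₀ (le_add_of_nonneg_left m.cast_nonneg), ?_⟩
    have hev : ∀ᶠ n : ℕ in atTop, ∀ i j : Fin K, (∑ t ∈ Finset.range n, Set.indicator
        (extremeSet ((m : ℝ) + 1)⁻¹) (fun _ => (1 : ℝ))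
        (g (t, i, j))) / n < θ / (K * K + 1) :=
      eventually_all.2 fun i => eventually_all.2 fun j => (h1 m i j).eventually_lt_const hm
    filter_upwards [hev, eventually_gt_atTop 0] with n hn hn0
    have hn0' : (0 : ℝ) < n := by exact_mod_cast hn0
    have hbad : ∀ t, (if ¬ GoodSlot ((m : ℝ) + 1)⁻¹ (coeff 1 .timeVarying g t) then (1 : ℝ)
        else 0) ≤ ∑ i, ∑ j, Set.indicator
        (extremeSet ((m : ℝ) + 1)⁻¹) (fun _ => (1 : ℝ))
        (g (t, i, j)) := by
      intro t
      have hnn : ∀ i j : Fin K, 0 ≤ Set.indicator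
          (extremeSet ((m : ℝ) + 1)⁻¹) (fun _ => (1 : ℝ))
          (g (t, i, j)) := fun i j => Set.indicator_nonneg (fun _ _ => zero_le_one) _
      split_ifs with h
      · exact Finset.sum_nonneg fun i _ => Finset.sum_nonneg fun j _ => hnn i j
      · simp only [GoodSlot, not_forall] at h
        obtain ⟨i, j, hij, h⟩ := h
        simp only [coeff, hij, if_true, Fading.draw] at h
        refine le_trans ?_ (Finset.single_le_sum (f := fun i => ∑ j, Set.indicator
          (extremeSet ((m : ℝ) + 1)⁻¹) (fun _ => (1 : ℝ))
          (g (t, i, j))) (fun i _ => Finset.sum_nonneg fun j _ => hnn i j) (Finset.mem_univ i))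
        refine le_trans ?_ (Finset.single_le_sum (fun j _ => hnn i j) (Finset.mem_univ j))
        rw [Set.indicator_of_mem]
        exact h
    rw [← Finset.sum_boole]
    calc _ ≤ ∑ t ∈ Finset.range n, ∑ i, ∑ j, Set.indicator
          (extremeSet ((m : ℝ) + 1)⁻¹) (fun _ => (1 : ℝ))
          (g (t, i, j)) := Finset.sum_le_sum fun t _ => hbad t
      _ = ∑ i, ∑ j, ∑ t ∈ Finset.range n, Set.indicator
          (extremeSet ((m : ℝ) + 1)⁻¹) (fun _ => (1 : ℝ))
          (g (t, i, j)) := by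
        rw [Finset.sum_comm]
        exact Finset.sum_congr rfl fun i _ => Finset.sum_comm
      _ ≤ ∑ _i : Fin K, ∑ _j : Fin K, θ / (K * K + 1) * n :=
        Finset.sum_le_sum fun i _ => Finset.sum_le_sum fun j _ =>
          ((div_lt_iff₀ hn0').1 (hn i j)).le
      _ = (K * K * (θ / (K * K + 1))) * n := by simp; ring
      _ ≤ θ * n := by
        refine mul_le_mul_of_nonneg_right ?_ hn0'.le
        rw [mul_div_assoc', div_le_iff₀ (by positivity)]
        nlinarith
  · have hev : ∀ᶠ n : ℕ in atTop, ∀ i j : Fin K,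
        (∑ t ∈ Finset.range n, Real.posLog ‖g (t, i, j)‖) / n < C + 1 :=
      eventually_all.2 fun i => eventually_all.2 fun j =>
        (h2 i j).eventually_lt_const (lt_add_one C)
    filter_upwards [hev, eventually_gt_atTop 0] with n hn hn0
    have hn0' : (0 : ℝ) < n := by exact_mod_cast hn0
    have hle : ∀ t i j, Real.posLog ‖coeff 1 .timeVarying g t i j‖ ≤
        Real.posLog ‖g (t, i, j)‖ := by
      intro t i j
      by_cases hij : Connected 1 i j
      · simp [coeff, hij, Fading.draw]
      · simp [coeff, hij, Real.posLog_nonneg]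
    calc _ ≤ ∑ t ∈ Finset.range n, ∑ i, ∑ j, Real.posLog ‖g (t, i, j)‖ :=
          Finset.sum_le_sum fun t _ => Finset.sum_le_sum fun i _ => Finset.sum_le_sum
            fun j _ => hle t i j
      _ = ∑ i, ∑ j, ∑ t ∈ Finset.range n, Real.posLog ‖g (t, i, j)‖ := by
        rw [Finset.sum_comm]
        exact Finset.sum_congr rfl fun i _ => Finset.sum_comm
      _ ≤ ∑ _i : Fin K, ∑ _j : Fin K, (C + 1) * n :=
        Finset.sum_le_sum fun i _ => Finset.sum_le_sum fun j _ =>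
          ((div_lt_iff₀ hn0').1 (hn i j)).le
      _ = K * (K * (C + 1)) * n := by simp; ring

theorem ae_regular (μ : Measure ℂ) [IsProbabilityMeasure μ] [NullSingletonClass μ] (f : Fading)
    (hμ : f = .timeVarying → Integrable (fun h : ℂ => Real.posLog ‖h‖) μ) (K : ℕ) :
    ∀ᵐ g ∂(drawLaw μ K), Regular (coeff 1 f g) := by
  cases f with
  | static =>
    have h : ∀ᵐ g ∂(drawLaw μ K), ∀ i j, g (0, i, j) ≠ 0 :=
      ae_all_iff.2 fun i => ae_all_iff.2 fun j =>
        (measurePreserving_eval_infinitePi (fun _ : ℕ × Fin K × Fin K => μ)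
          (0, i, j)).quasiMeasurePreserving.ae (Measure.ae_ne μ 0)
    filter_upwards [h] with g hg using regular_static hg
  | timeVarying =>
    have h1 := ae_all_iff.2 fun m : ℕ => ae_all_iff.2 fun i : Fin K => ae_all_iff.2 fun j =>
      ae_tendsto_average μ i j
        (measurable_const.indicator (measurableSet_extremeSet ((m : ℝ) + 1)⁻¹))
        ((integrable_const (1 : ℝ)).indicator (measurableSet_extremeSet ((m : ℝ) + 1)⁻¹))
    have h2 := ae_all_iff.2 fun i : Fin K => ae_all_iff.2 fun j =>
      ae_tendsto_average μ i j (Real.continuous_posLog.measurable.comp measurable_norm) (hμ rfl)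
    filter_upwards [h1, h2] with g hg1 hg2 using
      regular_timeVarying (tendsto_measure_extremeSet μ) hg1 hg2

/-! ### Codes with large Hamming distance -/

/-- A word of the ball is determined by the set of places where it differs from `x` and by its
values there. -/
theorem card_hammingBall_le {n : ℕ} {α : Type*} [Fintype α] [DecidableEq α] [Nonempty α]
    (x : Fin n → α) (d : ℕ) :
    (Finset.univ.filter fun y => hammingDist x y ≤ d).card ≤
      2 ^ n * Fintype.card α ^ d := by
  classical
  have hsub : (Finset.univ.filter fun y => hammingDist x y ≤ d) ⊆
      (Finset.univ.filter fun S : Finset (Fin n) => S.card ≤ d).biUnion fun S =>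
        Fintype.piFinset fun t => if t ∈ S then Finset.univ else {x t} := by
    intro y hy
    simp only [Finset.mem_filter, Finset.mem_univ, true_and] at hy
    simp only [Finset.mem_biUnion, Finset.mem_filter, Finset.mem_univ, true_and,
      Fintype.mem_piFinset]
    refine ⟨Finset.univ.filter fun t => x t ≠ y t, hy, fun t => ?_⟩
    by_cases ht : x t = y t <;> simp [ht]
  refine (Finset.card_le_card hsub).trans (Finset.card_biUnion_le.trans ?_)
  have hS : ∀ S ∈ (Finset.univ.filter fun S : Finset (Fin n) => S.card ≤ d),
      (Fintype.piFinset fun t => if t ∈ S then Finset.univ else {x t}).card ≤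
        Fintype.card α ^ d := by
    intro S hS
    simp only [Finset.mem_filter, Finset.mem_univ, true_and] at hS
    rw [Fintype.card_piFinset]
    have : ∀ t, (if t ∈ S then (Finset.univ : Finset α) else {x t}).card =
        if t ∈ S then Fintype.card α else 1 := fun t => by split_ifs <;> simp
    simp only [this, Finset.prod_ite_mem, Finset.univ_inter, Finset.prod_const]
    exact Nat.pow_le_pow_right Fintype.card_pos hS
  refine (Finset.sum_le_card_nsmul _ _ _ hS).trans ?_
  rw [smul_eq_mul]
  refine Nat.mul_le_mul_right _ ((Finset.card_filter_le _ _).trans ?_)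
  simp

/-- The Gilbert–Varshamov bound: a maximal code of minimum distance greater than `d` is large,
as the balls of radius `d` around its words cover everything. -/
theorem exists_code_of_distance (n : ℕ) (α : Type*) [Fintype α] [DecidableEq α] [Nonempty α]
    (d : ℕ) :
    ∃ C : Finset (Fin n → α), (∀ x ∈ C, ∀ y ∈ C, x ≠ y → d < hammingDist x y) ∧
      Fintype.card α ^ n ≤ C.card * (2 ^ n * Fintype.card α ^ d) := by
  classical
  obtain ⟨C, hC, hmax⟩ := Finset.exists_max_image
    (Finset.univ.filter fun C : Finset (Fin n → α) =>
      ∀ x ∈ C, ∀ y ∈ C, x ≠ y → d < hammingDist x y) Finset.card ⟨∅, by simp⟩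
  simp only [Finset.mem_filter, Finset.mem_univ, true_and] at hC hmax
  refine ⟨C, hC, ?_⟩
  have hcov : (Finset.univ : Finset (Fin n → α)) ⊆
      C.biUnion fun x => Finset.univ.filter fun y => hammingDist x y ≤ d := by
    intro y _
    by_contra hy
    simp only [Finset.mem_biUnion, Finset.mem_filter, Finset.mem_univ, true_and, not_exists,
      not_and, not_le] at hy
    have hyC : y ∉ C := fun h => by simpa using hy y h
    have := hmax (insert y C) (by
      intro a ha b hb hab
      rcases Finset.mem_insert.1 ha with ha' | ha' <;>
        rcases Finset.mem_insert.1 hb with hb' | hb'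
      · exact absurd (ha'.trans hb'.symm) hab
      · rw [ha', hammingDist_comm]; exact hy b hb'
      · rw [hb']; exact hy a ha'
      · exact hC a ha' b hb' hab)
    rw [Finset.card_insert_of_notMem hyC] at this
    omega
  have h := (Finset.card_le_card hcov).trans
    (Finset.card_biUnion_le_card_mul _ _ _ fun x _ => card_hammingBall_le x d)
  simpa using h

/-! ### Decoding with a bounded number of disturbed slots -/

/-- Minimum distance decoding with tolerance: if the code words differ in more than `4 * n / m`
slots and distinct constellation points are at least `2 * r` apart, then at most `2 * n / m`
slots with a disturbance of size `r` or more can be corrected. -/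
theorem exists_decoder {n m N : ℕ} (hN : 0 < N) {α : Type*} [DecidableEq α] (point : α → ℂ)
    {r : ℝ} (hpoint : ∀ a b, a ≠ b → 2 * r ≤ ‖point a - point b‖) (word : Fin N → Fin n → α)
    (hword : ∀ w w', w ≠ w' → 4 * n < m * hammingDist (word w) (word w')) :
    ∃ dec : (Fin n → ℂ) → Fin N, Measurable dec ∧ ∀ y w,
      m * (Finset.univ.filter fun t => r ≤ ‖y t - point (word w t)‖).card ≤ 2 * n →
        dec y = w := by
  classical
  have : Nonempty (Fin N) := ⟨⟨0, hN⟩⟩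
  obtain ⟨dec, hdec, h⟩ := exists_measurable_piecewise
    (fun w : Fin N => {y : Fin n → ℂ |
      m * (Finset.univ.filter fun t => r ≤ ‖y t - point (word w t)‖).card ≤ 2 * n})
    (fun w => by
      have hm : Measurable fun y : Fin n → ℂ =>
          (Finset.univ.filter fun t => r ≤ ‖y t - point (word w t)‖).card := by
        simp only [Finset.card_filter]
        refine Finset.measurable_sum _ fun t _ => Measurable.ite ?_ measurable_const
          measurable_const
        exact measurableSet_le measurable_const (by fun_prop)
      exact measurableSet_le (hm.const_mul m) measurable_const)
    (fun w _ => w) (fun w => measurable_const) (by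
      intro w w' hww' y hy
      exfalso
      refine absurd (hword w w' hww') (not_lt.2 ?_)
      have hsub : (Finset.univ.filter fun t => word w t ≠ word w' t) ⊆
          (Finset.univ.filter fun t => r ≤ ‖y t - point (word w t)‖) ∪
            Finset.univ.filter fun t => r ≤ ‖y t - point (word w' t)‖ := by
        intro t ht
        simp only [Finset.mem_filter, Finset.mem_univ, true_and, Finset.mem_union] at ht ⊢
        by_contra hcon
        push Not at hcon
        have h1 := hpoint _ _ ht
        have h2 := norm_sub_le (y t - point (word w' t)) (y t - point (word w t))
        rw [sub_sub_sub_cancel_left] at h2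
        linarith
      have hcard := (Finset.card_le_card hsub).trans (Finset.card_union_le _ _)
      have h1 : m * (Finset.univ.filter fun t => r ≤ ‖y t - point (word w t)‖).card ≤ 2 * n :=
        hy.1
      have h2 : m * (Finset.univ.filter fun t => r ≤ ‖y t - point (word w' t)‖).card ≤ 2 * n :=
        hy.2
      have h3 : m * hammingDist (word w) (word w') ≤ _ := Nat.mul_le_mul_left m hcard
      rw [Nat.mul_add] at h3
      omega)
  exact ⟨dec, hdec, fun y w hy => h w hy⟩

/-! ### Large noise is rare -/

theorem exists_noise_bound {p : ℝ} (hp : 0 < p) :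
    ∃ r : ℝ, 0 < r ∧ complexGaussian.real {z | r ≤ ‖z‖} ≤ p := by
  have hanti : Antitone fun k : ℕ => {z : ℂ | (k : ℝ) ≤ ‖z‖} := fun a b hab z hz =>
    le_trans (by exact_mod_cast hab) (show (b : ℝ) ≤ ‖z‖ from hz)
  have h := tendsto_measure_iInter_atTop (μ := complexGaussian)
    (s := fun k : ℕ => {z : ℂ | (k : ℝ) ≤ ‖z‖})
    (fun k => (measurableSet_le measurable_const measurable_norm).nullMeasurableSet) hanti
    ⟨0, measure_ne_top _ _⟩
  have hempty : ⋂ k : ℕ, {z : ℂ | (k : ℝ) ≤ ‖z‖} = ∅ := by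
    refine Set.eq_empty_of_forall_notMem fun z hz => ?_
    obtain ⟨k, hk⟩ := exists_nat_gt ‖z‖
    exact absurd (Set.mem_iInter.1 hz k) (not_le.2 hk)
  rw [hempty, measure_empty] at h
  have h' := (ENNReal.tendsto_toReal ENNReal.zero_ne_top).comp h
  obtain ⟨k, hk, hk0⟩ := ((h'.eventually_lt_const (show (0 : ENNReal).toReal < p by simpa)).and
    (eventually_gt_atTop 0)).exists
  exact ⟨k, by exact_mod_cast hk0, hk.le⟩

/-- If a single slot is disturbed with probability at most `4⁻¹ ^ m`, then it is exponentially
unlikely that more than `n / m` of `n` slots are disturbed. -/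
theorem noiseLaw_many_le {K n m : ℕ} (i : Fin K) {r : ℝ}
    (hr : complexGaussian.real {z | r ≤ ‖z‖} ≤ (1 / 4) ^ m) :
    (noiseLaw K n).real {z | n < m * (Finset.univ.filter fun t => r ≤ ‖z i t‖).card} ≤
      (1 / 2) ^ n := by
  classical
  have hsub : {z : Fin K → Fin n → ℂ |
      n < m * (Finset.univ.filter fun t => r ≤ ‖z i t‖).card} ⊆
      ⋃ S ∈ Finset.univ.filter fun S : Finset (Fin n) => n < m * S.card,
        {z | ∀ t ∈ S, r ≤ ‖z i t‖} := by
    intro z hz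
    refine Set.mem_iUnion₂.2 ⟨Finset.univ.filter fun t => r ≤ ‖z i t‖, by simpa using hz, ?_⟩
    intro t ht
    simpa using ht
  have hS : ∀ S ∈ Finset.univ.filter fun S : Finset (Fin n) => n < m * S.card,
      (noiseLaw K n).real {z | ∀ t ∈ S, r ≤ ‖z i t‖} ≤ (1 / 4) ^ n := by
    intro S hS
    simp only [Finset.mem_filter, Finset.mem_univ, true_and] at hS
    have h1 : {z : Fin K → Fin n → ℂ | ∀ t ∈ S, r ≤ ‖z i t‖} = (fun z => z i) ⁻¹'
        (Set.univ.pi fun t => if t ∈ S then {z : ℂ | r ≤ ‖z‖} else Set.univ) := by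
      ext z
      simp only [Set.mem_preimage, Set.mem_univ_pi]
      refine forall_congr' fun t => ?_
      by_cases ht : t ∈ S <;> simp [ht]
    have hm : MeasurableSet
        (Set.univ.pi fun t => if t ∈ S then {z : ℂ | r ≤ ‖z‖} else Set.univ) := by
      refine MeasurableSet.univ_pi fun t => ?_
      split_ifs
      · exact measurableSet_le measurable_const measurable_norm
      · exact MeasurableSet.univ
    have hmp : MeasurePreserving (fun z : Fin K → Fin n → ℂ => z i) (noiseLaw K n)
        (Measure.pi fun _ => complexGaussian) :=
      measurePreserving_eval (fun _ : Fin K => Measure.pi fun _ : Fin n => complexGaussian) i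
    rw [h1, hmp.measureReal_preimage hm.nullMeasurableSet, measureReal_def, Measure.pi_pi,
      ENNReal.toReal_prod]
    have h2 : ∀ t, (complexGaussian (if t ∈ S then {z : ℂ | r ≤ ‖z‖} else Set.univ)).toReal =
        if t ∈ S then complexGaussian.real {z : ℂ | r ≤ ‖z‖} else 1 := by
      intro t
      split_ifs <;> simp [measureReal_def]
    simp only [h2, Finset.prod_ite_mem, Finset.univ_inter, Finset.prod_const]
    calc complexGaussian.real {z : ℂ | r ≤ ‖z‖} ^ S.card ≤ ((1 / 4) ^ m) ^ S.card :=
          pow_le_pow_left₀ measureReal_nonneg hr _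
      _ = (1 / 4) ^ (m * S.card) := (pow_mul _ _ _).symm
      _ ≤ (1 / 4) ^ n := pow_le_pow_of_le_one (by norm_num) (by norm_num) hS.le
  calc _ ≤ (noiseLaw K n).real (⋃ S ∈ Finset.univ.filter
          fun S : Finset (Fin n) => n < m * S.card, {z | ∀ t ∈ S, r ≤ ‖z i t‖}) :=
        measureReal_mono hsub (measure_ne_top _ _)
    _ ≤ ∑ S ∈ Finset.univ.filter fun S : Finset (Fin n) => n < m * S.card,
          (noiseLaw K n).real {z | ∀ t ∈ S, r ≤ ‖z i t‖} := measureReal_biUnion_finset_le _ _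
    _ ≤ (Finset.univ.filter fun S : Finset (Fin n) => n < m * S.card).card • (1 / 4 : ℝ) ^ n :=
        Finset.sum_le_card_nsmul _ _ _ hS
    _ ≤ 2 ^ n * (1 / 4) ^ n := by
        rw [nsmul_eq_mul]
        refine mul_le_mul_of_nonneg_right ?_ (by positivity)
        have := Finset.card_filter_le (Finset.univ : Finset (Finset (Fin n)))
          fun S => n < m * S.card
        rw [Finset.card_univ, Fintype.card_finset, Fintype.card_fin] at this
        exact_mod_cast this
    _ = (1 / 2) ^ n := by rw [← mul_pow]; norm_num

/-! ### The transmission scheme -/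

/-- The users of complete clusters other than the centres. -/
def IsActive (M K : ℕ) (i : Fin K) : Prop :=
  (i : ℕ) / (2 * M + 1) < K / (2 * M + 1) ∧ (i : ℕ) % (2 * M + 1) ≠ M

/-- The transmitters that need to know message `i` in order to remove the interference it causes:
those from `i` up to the one in front of the centre, or those from the centre up to `i - 1`. -/
def schemeSet (M K : ℕ) (i : Fin K) : Finset (Fin K) :=
  Finset.univ.filter fun j =>
    ((i : ℕ) % (2 * M + 1) < M ∧ (i : ℕ) ≤ j ∧
      (j : ℕ) < (2 * M + 1) * ((i : ℕ) / (2 * M + 1)) + M) ∨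
    (M < (i : ℕ) % (2 * M + 1) ∧ (j : ℕ) < i ∧
      (2 * M + 1) * ((i : ℕ) / (2 * M + 1)) + M ≤ j)

theorem card_schemeSet_le (M K : ℕ) (i : Fin K) : (schemeSet M K i).card ≤ M := by
  have hi := Nat.div_add_mod (i : ℕ) (2 * M + 1)
  have hi' := Nat.mod_lt (i : ℕ) (show 2 * M + 1 > 0 by omega)
  rw [← Finset.card_map Fin.valEmbedding]
  rcases Nat.lt_or_ge ((i : ℕ) % (2 * M + 1)) M with h | h
  · have hs : (schemeSet M K i).map Fin.valEmbedding ⊆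
        Finset.Ico (i : ℕ) ((2 * M + 1) * ((i : ℕ) / (2 * M + 1)) + M) := by
      intro j hj
      simp only [schemeSet, Finset.mem_map, Finset.mem_filter, Finset.mem_univ, true_and,
        Fin.valEmbedding_apply] at hj
      obtain ⟨j, hj, rfl⟩ := hj
      rw [Finset.mem_Ico]
      omega
    refine (Finset.card_le_card hs).trans ?_
    rw [Nat.card_Ico]
    omega
  · have hs : (schemeSet M K i).map Fin.valEmbedding ⊆
        Finset.Ico ((2 * M + 1) * ((i : ℕ) / (2 * M + 1)) + M) (i : ℕ) := by
      intro j hj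
      simp only [schemeSet, Finset.mem_map, Finset.mem_filter, Finset.mem_univ, true_and,
        Fin.valEmbedding_apply] at hj
      obtain ⟨j, hj, rfl⟩ := hj
      rw [Finset.mem_Ico]
      omega
    refine (Finset.card_le_card hs).trans ?_
    rw [Nat.card_Ico]
    omega

/-- The transmit signals that produce the noiseless received signals `σ` at the active
receivers. The last transmitter of every complete cluster and all transmitters behind the
complete clusters are silent. -/
noncomputable def beamform (M : ℕ) {K : ℕ} (A : Matrix (Fin K) (Fin K) ℂ) (σ : Fin K → ℂ)
    (j : Fin K) : ℂ :=
  if (j : ℕ) / (2 * M + 1) < K / (2 * M + 1) then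
    if (j : ℕ) % (2 * M + 1) < M then
      sweepUp A ((2 * M + 1) * ((j : ℕ) / (2 * M + 1))) (extend σ) 0
        ((j : ℕ) % (2 * M + 1) + 1)
    else sweepDown M A ((2 * M + 1) * ((j : ℕ) / (2 * M + 1))) (extend σ) 0
      (2 * M - (j : ℕ) % (2 * M + 1))
  else 0

theorem cluster_lt {M K q s : ℕ} (hq : q < K / (2 * M + 1)) (hs : s ≤ 2 * M) :
    (2 * M + 1) * q + s < K := by
  have h1 := Nat.mul_le_mul_left (2 * M + 1) hq
  have h2 := Nat.mul_div_le K (2 * M + 1)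
  rw [Nat.succ_eq_add_one, Nat.mul_add] at h1
  omega

theorem cluster_mod {M q s : ℕ} (hs : s ≤ 2 * M) : ((2 * M + 1) * q + s) % (2 * M + 1) = s := by
  rw [Nat.mul_add_mod, Nat.mod_eq_of_lt (by omega)]

theorem cluster_div {M q s : ℕ} (hs : s ≤ 2 * M) : ((2 * M + 1) * q + s) / (2 * M + 1) = q := by
  rw [Nat.mul_add_div (by omega), Nat.div_eq_of_lt (by omega), add_zero]

/-- The transmitters from the centre of a complete cluster to its end carry the downward sweep. -/
theorem shifted_beamform_down {M K q s : ℕ} (A : Matrix (Fin K) (Fin K) ℂ) (σ : Fin K → ℂ)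
    (hq : q < K / (2 * M + 1)) (hs : s ≤ M) :
    shifted (beamform M A σ) ((2 * M + 1) * q + 2 * M + 1 - s) =
      sweepDown M A ((2 * M + 1) * q) (extend σ) 0 s := by
  have e : (2 * M + 1) * q + 2 * M + 1 - s = (2 * M + 1) * q + (2 * M - s) + 1 := by omega
  rw [e, shifted, extend, dif_pos (cluster_lt hq (by omega)), beamform]
  simp only [cluster_mod (show 2 * M - s ≤ 2 * M by omega),
    cluster_div (show 2 * M - s ≤ 2 * M by omega)]
  rw [if_pos hq, if_neg (by omega)]
  congr 1
  omega

/-- The transmitters in front of the centre of a complete cluster carry the upward sweep. -/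
theorem shifted_beamform_up {M K q s : ℕ} (A : Matrix (Fin K) (Fin K) ℂ) (σ : Fin K → ℂ)
    (hq : q < K / (2 * M + 1)) (hs : s ≤ M) :
    shifted (beamform M A σ) ((2 * M + 1) * q + s) =
      sweepUp A ((2 * M + 1) * q) (extend σ) 0 s := by
  rcases s with _ | s
  · rcases q with _ | q
    · rfl
    · -- the boundary transmitter belongs to the previous cluster
      have h := shifted_beamform_down (s := 0) A σ (show q < K / (2 * M + 1) by omega)
        (Nat.zero_le M)
      exact h
  · rw [← add_assoc, shifted, extend, dif_pos (cluster_lt hq (by omega)), beamform]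
    simp only [cluster_mod (show s ≤ 2 * M by omega), cluster_div (show s ≤ 2 * M by omega)]
    rw [if_pos hq, if_pos (by omega)]

/-- The active receivers get the wanted signals. -/
theorem sum_coeff_mul_beamform {M K : ℕ} {f : Fading} {g : ℕ × Fin K × Fin K → ℂ} {t : ℕ} {δ : ℝ}
    (hδ : 0 < δ) (hA : GoodSlot δ (coeff 1 f g t)) (σ : Fin K → ℂ) {i : Fin K}
    (hi : IsActive M K i) :
    ∑ j, coeff 1 f g t i j * beamform M (coeff 1 f g t) σ j = σ i := by
  rw [sum_coeff_mul f g t]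
  set A := coeff 1 f g t
  obtain ⟨hq, hs⟩ := hi
  have hdm := Nat.div_add_mod (i : ℕ) (2 * M + 1)
  have hlt := Nat.mod_lt (i : ℕ) (show 2 * M + 1 > 0 by omega)
  set q := (i : ℕ) / (2 * M + 1)
  set s := (i : ℕ) % (2 * M + 1)
  have hσ : extend σ ((2 * M + 1) * q + s) = σ i := by rw [hdm, extend_val]
  have hiK := cluster_lt (s := s) hq (by omega)
  rw [← hdm]
  rcases Nat.lt_or_ge s M with h | h
  · rw [add_assoc, shifted_beamform_up A σ hq (by omega), shifted_beamform_up A σ hq (by omega)]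
    refine (sweep_spec (a := fun s => direct A ((2 * M + 1) * q + s))
      (b := fun s => cross A ((2 * M + 1) * q + s)) ?_).trans hσ
    exact norm_pos_iff.1 (hδ.trans_le (hA.norm_direct hiK).1)
  · have e1 : (2 * M + 1) * q + s + 1 = (2 * M + 1) * q + 2 * M + 1 - (2 * M - s) := by omega
    have e2 : (2 * M + 1) * q + s = (2 * M + 1) * q + 2 * M + 1 - (2 * M - s + 1) := by omega
    have e3 : (2 * M + 1) * q + 2 * M - (2 * M - s) = (2 * M + 1) * q + s := by omega
    have h1 := shifted_beamform_down (s := 2 * M - s) A σ hq (by omega)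
    have h2 := shifted_beamform_down (s := 2 * M - s + 1) A σ hq (by omega)
    rw [← e1] at h1
    rw [← e2] at h2
    rw [h1, h2, add_comm, ← hσ]
    have h3 := sweep_spec (a := fun s => cross A ((2 * M + 1) * q + 2 * M - s))
      (b := fun s => direct A ((2 * M + 1) * q + 2 * M - s))
      (σ := fun s => extend σ ((2 * M + 1) * q + 2 * M - s)) (x₀ := 0) (s := 2 * M - s) (by
        simp only [e3]
        exact norm_pos_iff.1 (hδ.trans_le (hA.norm_cross hiK (by omega)).1))
    simp only [e3] at h3
    exact h3

theorem norm_beamform_le {M K : ℕ} {A : Matrix (Fin K) (Fin K) ℂ} {δ : ℝ}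
    (hδ : 0 < δ) (hδ1 : δ ≤ 1) (hA : GoodSlot δ A) {σ : Fin K → ℂ} {S : ℝ} (hS : ∀ i, ‖σ i‖ ≤ S)
    (j : Fin K) : ‖beamform M A σ j‖ ≤ M * (δ⁻¹ ^ 2) ^ M * S := by
  have hS0 : 0 ≤ S := (norm_nonneg _).trans (hS j)
  have h1 : 1 ≤ δ⁻¹ ^ 2 := one_le_pow₀ ((one_le_inv₀ hδ).2 hδ1)
  have hext : ∀ m, ‖extend σ m‖ ≤ S := by
    intro m
    unfold extend
    split_ifs
    · exact hS _
    · simpa using hS0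
  have hmono : ∀ s ≤ M, (s : ℝ) * (δ⁻¹ ^ 2) ^ s * S ≤ M * (δ⁻¹ ^ 2) ^ M * S := by
    intro s hs
    have h2 : (s : ℝ) ≤ M := by exact_mod_cast hs
    gcongr
  have hlt := Nat.mod_lt (j : ℕ) (show 2 * M + 1 > 0 by omega)
  unfold beamform
  split_ifs with hq hs
  · refine le_trans (norm_sweep_le hδ hδ1 (m := M) (fun s hs => ?_) (fun s hs => ?_)
      (fun s _ => hext _) _ (by omega)) (hmono _ (by omega))
    · exact (hA.norm_direct (cluster_lt hq (by omega))).1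
    · exact hA.norm_cross_le hδ (cluster_lt hq (by omega))
  · have hK := cluster_lt (s := 2 * M) hq le_rfl
    refine le_trans (norm_sweep_le hδ hδ1 (m := M) (fun s hs => ?_) (fun s hs => ?_)
      (fun s _ => hext _) _ (by omega)) (hmono _ (by omega))
    · exact (hA.norm_cross (by omega) (by omega)).1
    · exact (hA.norm_direct (by omega)).2
  · rw [norm_zero]
    positivity

/-- Transmitter `j` uses only the symbols of the messages that it knows. -/
theorem beamform_congr {M K : ℕ} (A : Matrix (Fin K) (Fin K) ℂ) {σ σ' : Fin K → ℂ} {j : Fin K}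
    (h : ∀ i, IsActive M K i → j ∈ schemeSet M K i → σ i = σ' i) :
    beamform M A σ j = beamform M A σ' j := by
  unfold beamform
  have hdm := Nat.div_add_mod (j : ℕ) (2 * M + 1)
  have hlt := Nat.mod_lt (j : ℕ) (show 2 * M + 1 > 0 by omega)
  set q := (j : ℕ) / (2 * M + 1)
  split_ifs with hq hs
  · refine sweep_congr (fun s hs => ?_) _ le_rfl
    have hK := cluster_lt (s := s) hq (by omega)
    simp only [extend, hK, dite_true]
    refine h _ ⟨?_, ?_⟩ ?_
    · simpa only [cluster_div (show s ≤ 2 * M by omega)] using hq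
    · simp only [cluster_mod (show s ≤ 2 * M by omega)]
      omega
    · simp only [schemeSet, Finset.mem_filter, Finset.mem_univ, true_and,
        cluster_mod (show s ≤ 2 * M by omega), cluster_div (show s ≤ 2 * M by omega)]
      omega
  · refine sweep_congr (fun s hs => ?_) _ le_rfl
    have e : (2 * M + 1) * q + 2 * M - s = (2 * M + 1) * q + (2 * M - s) := by omega
    have hK := cluster_lt (s := 2 * M - s) hq (by omega)
    simp only [e, extend, hK, dite_true]
    refine h _ ⟨?_, ?_⟩ ?_
    · simpa only [cluster_div (show 2 * M - s ≤ 2 * M by omega)] using hq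
    · simp only [cluster_mod (show 2 * M - s ≤ 2 * M by omega)]
      omega
    · simp only [schemeSet, Finset.mem_filter, Finset.mem_univ, true_and,
        cluster_mod (show 2 * M - s ≤ 2 * M by omega),
        cluster_div (show 2 * M - s ≤ 2 * M by omega)]
      omega
  · rfl

/-! ### Achievability -/

open Classical in
/-- A codebook for each user: one of large Hamming distance for an active user, and a single word
for a user that is switched off. -/
theorem exists_codebook (n : ℕ) {m : ℕ} (hm : 0 < m) (α : Type*) [Fintype α] [DecidableEq α]
    [Nonempty α] (active : Prop) :
    ∃ N : ℕ, 0 < N ∧ ∃ word : Fin N → Fin n → α,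
      (∀ w w', w ≠ w' → 4 * n < m * hammingDist (word w) (word w')) ∧
      (active → Fintype.card α ^ n ≤ N * (2 ^ n * Fintype.card α ^ (4 * n / m))) ∧
      (¬ active → N = 1) := by
  by_cases h : active
  · obtain ⟨C, hC, hcard⟩ := exists_code_of_distance n α (4 * n / m)
    refine ⟨C.card, ?_, fun w => (C.equivFin.symm w : Fin n → α), fun w w' hw => ?_,
      fun _ => hcard, fun h' => absurd h h'⟩
    · refine Nat.pos_of_ne_zero fun h0 => ?_
      rw [h0, zero_mul] at hcard
      exact absurd hcard (not_le.2 (pow_pos Fintype.card_pos n))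
    · have := hC _ (C.equivFin.symm w).2 _ (C.equivFin.symm w').2
        fun he => hw (C.equivFin.symm.injective (Subtype.ext he))
      rw [Nat.div_lt_iff_lt_mul hm] at this
      exact this.trans_eq (mul_comm _ _)
  · exact ⟨1, one_pos, fun _ _ => Classical.arbitrary α,
      fun w w' hw => absurd (Subsingleton.elim w w') hw, fun h' => absurd h' h, fun _ => rfl⟩

open Classical in
/-- A code for the scheme: the symbols of outer codes of large Hamming distance are sent with
`beamform` in the good slots, and nothing is sent in the others. -/
theorem exists_scheme_code {K n M m : ℕ} (hm : 0 < m) (f : Fading)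
    (g : ℕ × Fin K × Fin K → ℂ) {δ : ℝ} (hδ : 0 < δ) (hδ1 : δ ≤ 1) {α : Type*} [Fintype α]
    [DecidableEq α] [Nonempty α] (point : α → ℂ) {r S P : ℝ}
    (hpoint : ∀ a b, a ≠ b → 2 * r ≤ ‖point a - point b‖) (hS0 : 0 ≤ S)
    (hS : ∀ a, ‖point a‖ ≤ S) (hP : (M * (δ⁻¹ ^ 2) ^ M * S) ^ 2 ≤ P)
    (hr : complexGaussian.real {z | r ≤ ‖z‖} ≤ (1 / 4) ^ m)
    (hbad : m * ((Finset.range n).filter fun t => ¬ GoodSlot δ (coeff 1 f g t)).card ≤ n) :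
    ∃ c : Code K n (schemeSet M K) P, (∀ i, 0 < c.size i) ∧
      (∀ i, IsActive M K i →
        Fintype.card α ^ n ≤ c.size i * (2 ^ n * Fintype.card α ^ (4 * n / m))) ∧
      ∀ i, c.errorProb (coeff 1 f g) i ≤ (1 / 2) ^ n := by
  choose N hN word hword hrate hone using fun i : Fin K =>
    exists_codebook n hm α (IsActive M K i)
  choose dec hdec hdecw using fun i : Fin K =>
    exists_decoder (hN i) point hpoint (word i) (hword i)
  let symbol : (∀ i, Fin (N i)) → Fin n → Fin K → ℂ := fun w t i =>
    if IsActive M K i then point (word i (w i) t) else 0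
  have hsymbol : ∀ w t i, ‖symbol w t i‖ ≤ S := by
    intro w t i
    simp only [symbol]
    split_ifs
    · exact hS _
    · simpa using hS0
  have hP0 : 0 ≤ P := (sq_nonneg _).trans hP
  let enc : Fin K → (∀ i, Fin (N i)) → Fin n → ℂ := fun j w t =>
    if GoodSlot δ (coeff 1 f g t) then beamform M (coeff 1 f g t) (symbol w t) j else 0
  have henc : ∀ j w w', (∀ i, j ∈ schemeSet M K i → w i = w' i) → enc j w = enc j w' := by
    intro j w w' h
    funext t
    simp only [enc]
    rw [beamform_congr (σ' := symbol w' t) _ fun i hi hj => ?_]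
    simp only [symbol, h i hj]
  have hpow : ∀ j w, ∑ t, ‖enc j w t‖ ^ 2 ≤ n * P := by
    intro j w
    have hslot : ∀ t : Fin n, ‖enc j w t‖ ^ 2 ≤ P := by
      intro t
      simp only [enc]
      split_ifs with hg
      · exact (pow_le_pow_left₀ (norm_nonneg _)
          (norm_beamform_le hδ hδ1 hg (hsymbol w t) j) 2).trans hP
      · simpa using hP0
    refine (Finset.sum_le_card_nsmul _ _ _ fun t _ => hslot t).trans (le_of_eq ?_)
    simp
  let c : Code K n (schemeSet M K) P := ⟨N, enc, dec, henc, hpow, hdec⟩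
  refine ⟨c, hN, hrate, fun i => ?_⟩
  have hcard : ((Finset.univ : Finset (∀ i, Fin (N i))).card : ℝ) = ∏ k, (N k : ℝ) := by
    simp [Fintype.card_pi]
  have hprod : 0 < ∏ k, (N k : ℝ) := Finset.prod_pos fun k _ => by exact_mod_cast hN k
  have hterm : ∀ w : ∀ i, Fin (N i), (noiseLaw K n).real
      {z | dec i (received (coeff 1 f g) (fun j => enc j w) z i) ≠ w i} ≤ (1 / 2) ^ n := by
    intro w
    by_cases hi : IsActive M K i
    · refine le_trans (measureReal_mono ?_ (measure_ne_top _ _)) (noiseLaw_many_le i hr)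
      intro z hz
      by_contra hz'
      refine hz (hdecw i _ _ ?_)
      have hz'' : m * (Finset.univ.filter fun t => r ≤ ‖z i t‖).card ≤ n := not_lt.1 hz'
      -- a slot is disturbed only if it is not good or if the noise is large
      have hsub : (Finset.univ.filter fun t => r ≤
          ‖received (coeff 1 f g) (fun j => enc j w) z i t - point (word i (w i) t)‖) ⊆
          (Finset.univ.filter fun t : Fin n => ¬ GoodSlot δ (coeff 1 f g t)) ∪
            Finset.univ.filter fun t => r ≤ ‖z i t‖ := by
        intro t ht
        simp only [Finset.mem_filter, Finset.mem_univ, true_and, Finset.mem_union] at ht ⊢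
        by_cases hg : GoodSlot δ (coeff 1 f g t)
        · right
          have h1 := sum_coeff_mul_beamform hδ hg (symbol w t) hi
          have h2 : received (coeff 1 f g) (fun j => enc j w) z i t =
              point (word i (w i) t) + z i t := by
            simp only [received, enc, hg, if_true]
            rw [h1]
            simp only [symbol, hi, if_true]
          rwa [h2, add_sub_cancel_left] at ht
        · exact Or.inl hg
      have hbad' : (Finset.univ.filter fun t : Fin n => ¬ GoodSlot δ (coeff 1 f g t)).card ≤
          ((Finset.range n).filter fun t => ¬ GoodSlot δ (coeff 1 f g t)).card := by
        refine Finset.card_le_card_of_injOn (fun t => (t : ℕ)) (fun t ht => ?_)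
          fun t _ t' _ h => Fin.ext h
        simpa using ht
      have h3 := (Finset.card_le_card hsub).trans (Finset.card_union_le _ _)
      have h4 := Nat.mul_le_mul_left m h3
      have h5 := Nat.mul_le_mul_left m hbad'
      rw [Nat.mul_add] at h4
      omega
    · have hsub : ∀ a b : Fin (N i), a = b := by
        rw [hone i hi]
        exact fun a b => Subsingleton.elim a b
      have : {z | dec i (received (coeff 1 f g) (fun j => enc j w) z i) ≠ w i} = ∅ :=
        Set.eq_empty_of_forall_notMem fun z hz => hz (hsub _ _)
      rw [this, measureReal_empty]
      positivity
  unfold Code.errorProb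
  rw [div_le_iff₀ hprod]
  refine (Finset.sum_le_card_nsmul _ _ _ fun w _ => hterm w).trans (le_of_eq ?_)
  rw [nsmul_eq_mul, mul_comm]
  exact congrArg _ hcard

/-- The square constellation with `Q * Q` points and spacing `2 * r`. -/
noncomputable def gridPoint (Q : ℕ) (r : ℝ) (a : Fin Q × Fin Q) : ℂ :=
  ⟨2 * r * (a.1 : ℕ), 2 * r * (a.2 : ℕ)⟩

theorem le_norm_gridPoint_sub {Q : ℕ} {r : ℝ} (hr : 0 < r) {a b : Fin Q × Fin Q} (hab : a ≠ b) :
    2 * r ≤ ‖gridPoint Q r a - gridPoint Q r b‖ := by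
  have key : ∀ k l : ℕ, k ≠ l → 2 * r ≤ |2 * r * (k : ℝ) - 2 * r * l| := by
    intro k l hkl
    rw [← mul_sub, abs_mul, abs_of_pos (by positivity : 0 < 2 * r)]
    refine le_mul_of_one_le_right (by positivity) ?_
    have h1 : (1 : ℤ) ≤ |(k : ℤ) - l| := Int.one_le_abs (by omega)
    exact_mod_cast h1
  by_cases h : a.1 = b.1
  · have h2 : (a.2 : ℕ) ≠ b.2 := fun he => hab (Prod.ext h (Fin.ext he))
    exact (key _ _ h2).trans (Complex.abs_im_le_norm (gridPoint Q r a - gridPoint Q r b))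
  · have h1 : (a.1 : ℕ) ≠ b.1 := fun he => h (Fin.ext he)
    exact (key _ _ h1).trans (Complex.abs_re_le_norm (gridPoint Q r a - gridPoint Q r b))

theorem norm_gridPoint_le {Q : ℕ} {r : ℝ} (hr : 0 < r) (a : Fin Q × Fin Q) :
    ‖gridPoint Q r a‖ ≤ 4 * r * Q := by
  refine (Complex.norm_le_abs_re_add_abs_im _).trans ?_
  have h1 : ((a.1 : ℕ) : ℝ) ≤ Q := by exact_mod_cast a.1.2.le
  have h2 : ((a.2 : ℕ) : ℝ) ≤ Q := by exact_mod_cast a.2.2.le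
  simp only [gridPoint]
  rw [abs_of_nonneg (by positivity), abs_of_nonneg (by positivity)]
  nlinarith

/-- Rate zero needs a single message for every receiver only. -/
theorem rateAchievable_zero {K : ℕ} (T : Fin K → Finset (Fin K))
    (H : ℕ → Matrix (Fin K) (Fin K) ℂ) {P : ℝ} (hP : 0 ≤ P) : RateAchievable T H P 0 := by
  refine ⟨fun i => le_rfl, fun ε hε => ⟨0, fun n _ => ?_⟩⟩
  refine ⟨⟨fun _ => 1, fun _ _ _ => 0, fun _ _ => 0, fun _ _ _ _ => rfl, fun j w => ?_,
    fun i => measurable_const⟩, fun i => by simp, fun i => ?_⟩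
  · simp only [norm_zero, ne_eq, OfNat.ofNat_ne_zero, not_false_eq_true, zero_pow,
      Finset.sum_const_zero]
    positivity
  · unfold Code.errorProb
    rw [Finset.sum_eq_zero]
    · simpa using hε.le
    · intro w _
      refine (congrArg _ (Set.eq_empty_of_forall_notMem fun z hz => ?_)).trans measureReal_empty
      exact hz (Subsingleton.elim (α := Fin 1) _ _)

open Classical in
/-- For large power the active users achieve the rate `(1 - ε) * log P`. -/
theorem rateAchievable_scheme {K M : ℕ} (hM : 1 ≤ M) (f : Fading) (g : ℕ × Fin K × Fin K → ℂ)
    (hreg : Regular (coeff 1 f g)) {ε : ℝ} (hε : 0 < ε) (hε1 : ε ≤ 1) :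
    ∀ᶠ P in atTop, RateAchievable (schemeSet M K) (coeff 1 f g) P
      fun i => if IsActive M K i then (1 - ε) * Real.log P else 0 := by
  -- `4 / m` is the fraction of the symbols spent on the minimum distance
  obtain ⟨m, hmε⟩ := exists_nat_gt (8 / ε)
  have hm0 : (0 : ℝ) < m := (by positivity : 0 < 8 / ε).trans hmε
  have hm : 0 < m := by exact_mod_cast hm0
  obtain ⟨δ, hδ, hδ1, hbad⟩ := hreg.1 (1 / m) (by positivity)
  obtain ⟨r, hr0, hr⟩ := exists_noise_bound (p := (1 / 4) ^ m) (by positivity)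
  set κ : ℝ := M * (δ⁻¹ ^ 2) ^ M * (4 * r) with hκ
  have hM0 : (0 : ℝ) < M := by exact_mod_cast hM
  have hκ0 : 0 < κ := by positivity
  have hlarge : ∀ᶠ P : ℝ in atTop,
      Real.log 2 + 2 * |Real.log (2 * κ)| ≤ ε / 2 * Real.log P :=
    (Real.tendsto_log_atTop.const_mul_atTop (by positivity)).eventually_ge_atTop _
  filter_upwards [hlarge, eventually_ge_atTop (κ ^ 2), eventually_ge_atTop 1] with P hPl hPκ hP1
  have hP0 : 0 < P := by linarith
  have hlogP := Real.log_nonneg hP1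
  set Q : ℕ := ⌊√P / κ⌋₊ with hQ
  have hsq : κ ≤ √P := Real.le_sqrt_of_sq_le hPκ
  have h1 : 1 ≤ √P / κ := (one_le_div hκ0).2 hsq
  have hQ1 : 1 ≤ Q := Nat.le_floor (by exact_mod_cast h1)
  have hQle : κ * Q ≤ √P := by
    have := Nat.floor_le (zero_le_one.trans h1)
    rwa [le_div_iff₀ hκ0, mul_comm] at this
  have hQge : √P ≤ 2 * κ * Q := by
    have h2 := (Nat.lt_floor_add_one (√P / κ)).le
    rw [div_le_iff₀ hκ0] at h2
    have h3 : (1 : ℝ) ≤ Q := by exact_mod_cast hQ1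
    have h4 : ((Q : ℝ) + 1) * κ ≤ (2 * Q) * κ :=
      mul_le_mul_of_nonneg_right (by linarith) hκ0.le
    linarith
  have hQ0 : (0 : ℝ) < Q := by exact_mod_cast hQ1
  have : Nonempty (Fin Q × Fin Q) := ⟨(⟨0, hQ1⟩, ⟨0, hQ1⟩)⟩
  -- the constellation has about `P` points
  have hlogQ : Real.log P - 2 * |Real.log (2 * κ)| ≤ Real.log ((Q * Q : ℕ) : ℝ) := by
    have h2 := Real.log_le_log (Real.sqrt_pos.2 hP0) hQge
    rw [Real.log_sqrt hP0.le, Real.log_mul (by positivity) hQ0.ne'] at h2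
    rw [Nat.cast_mul, Real.log_mul hQ0.ne' hQ0.ne']
    have := le_abs_self (Real.log (2 * κ))
    linarith
  have hlogQ0 : 0 ≤ Real.log ((Q * Q : ℕ) : ℝ) :=
    Real.log_nonneg (by exact_mod_cast Nat.mul_pos hQ1 hQ1)
  refine ⟨fun i => ?_, fun ε' hε' => ?_⟩
  · beta_reduce
    split_ifs
    · exact mul_nonneg (by linarith) hlogP
    · exact le_rfl
  have hhalf : ∀ᶠ n : ℕ in atTop, ((1 : ℝ) / 2) ^ n ≤ ε' :=
    (tendsto_pow_atTop_nhds_zero_of_lt_one (by norm_num) (by norm_num)).eventually_le_const hε'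
  obtain ⟨n₀, hn₀⟩ := eventually_atTop.1 (hbad.and hhalf)
  refine ⟨n₀, fun n hn => ?_⟩
  obtain ⟨hbadn, hhalfn⟩ := hn₀ n hn
  obtain ⟨c, hc, hrate, herr⟩ := exists_scheme_code (P := P) (M := M) (n := n) hm f g hδ hδ1
    (gridPoint Q r) (fun a b hab => le_norm_gridPoint_sub hr0 hab)
    (by positivity) (norm_gridPoint_le hr0) (by
      have : (M : ℝ) * (δ⁻¹ ^ 2) ^ M * (4 * r * Q) = κ * Q := by rw [hκ]; ring
      rw [this]
      exact (pow_le_pow_left₀ (by positivity) hQle 2).trans (Real.sq_sqrt hP0.le).le) hr (by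
      rw [one_div_mul_eq_div, le_div_iff₀ hm0, mul_comm] at hbadn
      exact_mod_cast hbadn)
  refine ⟨c, fun i => ?_, fun i => (herr i).trans hhalfn⟩
  have hci : (0 : ℝ) < c.size i := by exact_mod_cast hc i
  beta_reduce
  split_ifs with hi
  · rw [← Real.le_log_iff_exp_le hci]
    have hq := hrate i hi
    rw [Fintype.card_prod, Fintype.card_fin] at hq
    have hq' : (((Q * Q : ℕ) : ℝ)) ^ n ≤
        c.size i * (2 ^ n * ((Q * Q : ℕ) : ℝ) ^ (4 * n / m)) := by exact_mod_cast hq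
    have hQQ : (0 : ℝ) < ((Q * Q : ℕ) : ℝ) := by exact_mod_cast Nat.mul_pos hQ1 hQ1
    have hl := Real.log_le_log (by positivity) hq'
    rw [Real.log_mul hci.ne' (by positivity), Real.log_mul (by positivity) (by positivity),
      Real.log_pow, Real.log_pow, Real.log_pow] at hl
    set L := Real.log ((Q * Q : ℕ) : ℝ)
    have hfloor : ((4 * n / m : ℕ) : ℝ) ≤ ε / 2 * n := by
      refine Nat.cast_div_le.trans ?_
      push_cast
      rw [div_le_iff₀ hm0]
      rw [div_lt_iff₀ hε] at hmε
      nlinarith [n.cast_nonneg (α := ℝ)]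
    have h5 := mul_le_mul_of_nonneg_right hfloor hlogQ0
    have h6 : (1 - ε / 2) * (Real.log P - 2 * |Real.log (2 * κ)|) ≤ (1 - ε / 2) * L :=
      mul_le_mul_of_nonneg_left hlogQ (by linarith)
    have h7 : 0 ≤ ε / 2 * (2 * |Real.log (2 * κ)|) := by positivity
    have h8 : (1 - ε) * Real.log P ≤ (1 - ε / 2) * L - Real.log 2 := by linarith
    have h9 := mul_le_mul_of_nonneg_left h8 (n.cast_nonneg (α := ℝ))
    linarith
  · rw [mul_zero, Real.exp_zero]
    exact_mod_cast hc i

open Classical in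
theorem dofAchievable_scheme {K M : ℕ} (hM : 1 ≤ M) (f : Fading) (g : ℕ × Fin K × Fin K → ℂ)
    (hreg : Regular (coeff 1 f g)) {ε : ℝ} (hε : 0 < ε) (hε1 : ε ≤ 1) :
    DoFAchievable (schemeSet M K) (coeff 1 f g) fun i => if IsActive M K i then 1 - ε else 0 := by
  obtain ⟨P₀, hP₀⟩ := eventually_atTop.1 (rateAchievable_scheme hM f g hreg hε hε1)
  refine ⟨fun P => if P₀ ≤ P then fun i => if IsActive M K i then (1 - ε) * Real.log P else 0
    else 0, fun P hP => ?_, fun i => ?_⟩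
  · beta_reduce
    split_ifs with h
    · exact hP₀ P h
    · exact rateAchievable_zero _ _ hP.le
  · refine tendsto_const_nhds.congr' ?_
    filter_upwards [eventually_ge_atTop P₀, eventually_gt_atTop 1] with P h h1
    have hlog := (Real.log_pos h1).ne'
    by_cases hi : IsActive M K i <;> simp [h, hi, hlog]

/-! ### The number of degrees of freedom -/

open Classical in
theorem le_card_isActive (M K : ℕ) :
    K / (2 * M + 1) * (2 * M) ≤ (Finset.univ.filter fun i => IsActive M K i).card := by
  have hM : M < 2 * M + 1 := by omega
  have h := Finset.card_le_card_of_injOn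
    (s := (Finset.univ : Finset (Fin (K / (2 * M + 1)))) ×ˢ
      (Finset.univ : Finset (Fin (2 * M + 1))).erase ⟨M, hM⟩)
    (t := Finset.univ.filter fun i => IsActive M K i)
    (fun p => ⟨(2 * M + 1) * (p.1 : ℕ) + p.2, cluster_lt p.1.2 (by omega)⟩)
    (fun p hp => ?_) (fun p _ p' _ he => ?_)
  · simpa using h
  · rw [Finset.mem_coe, Finset.mem_product, Finset.mem_erase] at hp
    have hs : (p.2 : ℕ) ≤ 2 * M := by omega
    refine Finset.mem_coe.2 (Finset.mem_filter.2 ⟨Finset.mem_univ _, ?_, ?_⟩)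
    · simp only [cluster_div hs]
      exact p.1.2
    · simp only [cluster_mod hs]
      exact fun h => hp.2.1 (Fin.ext h)
  · have hs : (p.2 : ℕ) ≤ 2 * M := by omega
    have hs' : (p'.2 : ℕ) ≤ 2 * M := by omega
    have he' : (2 * M + 1) * (p.1 : ℕ) + p.2 = (2 * M + 1) * (p'.1 : ℕ) + p'.2 :=
      congrArg Fin.val he
    refine Prod.ext (Fin.ext ?_) (Fin.ext ?_)
    · rw [← cluster_div (q := p.1) hs, he', cluster_div hs']
    · rw [← cluster_mod (q := p.1) hs, he', cluster_mod hs']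

instance isProbabilityMeasure_drawLaw (μ : Measure ℂ) [IsProbabilityMeasure μ] (K : ℕ) :
    IsProbabilityMeasure (drawLaw μ K) := by
  unfold drawLaw
  infer_instance

theorem dofRegion_subset (μ : Measure ℂ) [IsProbabilityMeasure μ] [NullSingletonClass μ]
    (f : Fading) (hμ : f = .timeVarying → Integrable (fun h : ℂ => Real.posLog ‖h‖) μ)
    {K M : ℕ} {T : Fin K → Finset (Fin K)} (hT : ∀ i, (T i).card ≤ M) :
    dofRegion μ f 1 T ⊆
      {d | (∀ i, 0 ≤ d i) ∧ ∑ i, d i ≤ K - (K / (2 * M + 1) : ℕ)} := by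
  refine closure_minimal (fun d hd => ?_) ?_
  · have hd' : ∀ᵐ g ∂(drawLaw μ K), DoFAchievable T (coeff 1 f g) d := hd
    obtain ⟨g, hg, hreg⟩ := (hd'.and (ae_regular μ f hμ K)).exists
    exact ⟨dof_nonneg hg, sum_dof_le hT f g hreg hg⟩
  · have h1 : IsClosed {d : Fin K → ℝ | ∀ i, 0 ≤ d i} := by
      simp only [Set.ofPred_forall]
      exact isClosed_iInter fun i => isClosed_le continuous_const (continuous_apply i)
    exact h1.inter (isClosed_le (continuous_finsetSum _ fun i _ => continuous_apply i)
      continuous_const)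

theorem isCompact_dofRegion (μ : Measure ℂ) [IsProbabilityMeasure μ] [NullSingletonClass μ]
    (f : Fading) (hμ : f = .timeVarying → Integrable (fun h : ℂ => Real.posLog ‖h‖) μ)
    {K M : ℕ} {T : Fin K → Finset (Fin K)}
    (hT : ∀ i, (T i).card ≤ M) : IsCompact (dofRegion μ f 1 T) := by
  refine (isCompact_Icc (a := (0 : Fin K → ℝ)) (b := fun _ => (K : ℝ))).of_isClosed_subset
    isClosed_closure fun d hd => ?_
  obtain ⟨h0, hsum⟩ := dofRegion_subset μ f hμ hT hd
  refine ⟨h0, fun i => (Finset.single_le_sum (fun j _ => h0 j) (Finset.mem_univ i)).trans ?_⟩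
  have : (0 : ℝ) ≤ (K / (2 * M + 1) : ℕ) := Nat.cast_nonneg _
  linarith

theorem isCompact_sumDoFs (μ : Measure ℂ) [IsProbabilityMeasure μ] [NullSingletonClass μ]
    (f : Fading) (hμ : f = .timeVarying → Integrable (fun h : ℂ => Real.posLog ‖h‖) μ)
    (M K : ℕ) : IsCompact (sumDoFs μ f 1 M K) := by
  have h : sumDoFs μ f 1 M K = ⋃ T ∈ {T : Fin K → Finset (Fin K) | ∀ i, (T i).card ≤ M},
      (fun d : Fin K → ℝ => ∑ i, d i) '' dofRegion μ f 1 T := by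
    ext s
    simp only [sumDoFs, Set.mem_ofPred_eq, Set.mem_iUnion, Set.mem_image, exists_prop, eq_comm]
  rw [h]
  exact (Set.toFinite _).isCompact_biUnion fun T hT => (isCompact_dofRegion μ f hμ hT).image
    (continuous_finsetSum _ fun i _ => continuous_apply i)

open Classical in
/-- For `ε = 1` this shows that the set of sums is not empty. -/
theorem mul_card_isActive_mem_sumDoFs (μ : Measure ℂ) [IsProbabilityMeasure μ]
    [NullSingletonClass μ] (f : Fading)
    (hμ : f = .timeVarying → Integrable (fun h : ℂ => Real.posLog ‖h‖) μ)
    {M : ℕ} (hM : 1 ≤ M) (K : ℕ) {ε : ℝ} (hε : 0 < ε)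
    (hε1 : ε ≤ 1) :
    ((Finset.univ.filter fun i => IsActive M K i).card : ℝ) * (1 - ε) ∈ sumDoFs μ f 1 M K := by
  refine ⟨schemeSet M K, card_schemeSet_le M K, fun i => if IsActive M K i then 1 - ε else 0,
    subset_closure ?_, ?_⟩
  · filter_upwards [ae_regular μ f hμ K] with g hreg using
      dofAchievable_scheme hM f g hreg hε hε1
  · rw [Finset.sum_ite, Finset.sum_const_zero, add_zero, Finset.sum_const, nsmul_eq_mul]

theorem isGreatest_totalDoF (μ : Measure ℂ) [IsProbabilityMeasure μ] [NullSingletonClass μ]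
    (f : Fading) (hμ : f = .timeVarying → Integrable (fun h : ℂ => Real.posLog ‖h‖) μ)
    {M : ℕ} (hM : 1 ≤ M) (K : ℕ) :
    IsGreatest (sumDoFs μ f 1 M K) (totalDoF μ f 1 M K) :=
  (isCompact_sumDoFs μ f hμ M K).isGreatest_sSup
    ⟨_, mul_card_isActive_mem_sumDoFs μ f hμ hM K one_pos le_rfl⟩

theorem totalDoF_le (μ : Measure ℂ) [IsProbabilityMeasure μ] [NullSingletonClass μ]
    (f : Fading) (hμ : f = .timeVarying → Integrable (fun h : ℂ => Real.posLog ‖h‖) μ)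
    {M : ℕ} (hM : 1 ≤ M) (K : ℕ) :
    totalDoF μ f 1 M K ≤ K - (K / (2 * M + 1) : ℕ) := by
  obtain ⟨T, hT, d, hd, h⟩ := (isGreatest_totalDoF μ f hμ hM K).1
  rw [h]
  exact (dofRegion_subset μ f hμ hT hd).2

theorem le_totalDoF (μ : Measure ℂ) [IsProbabilityMeasure μ] [NullSingletonClass μ]
    (f : Fading) (hμ : f = .timeVarying → Integrable (fun h : ℂ => Real.posLog ‖h‖) μ)
    {M : ℕ} (hM : 1 ≤ M) (K : ℕ) :
    2 * M * ((K / (2 * M + 1) : ℕ) : ℝ) ≤ totalDoF μ f 1 M K := by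
  classical
  have h1 : ((K / (2 * M + 1) * (2 * M) : ℕ) : ℝ) ≤
      (Finset.univ.filter fun i => IsActive M K i).card := by
    exact_mod_cast le_card_isActive M K
  have h2 : Tendsto (fun ε : ℝ => ((Finset.univ.filter fun i => IsActive M K i).card : ℝ) *
      (1 - ε)) (𝓝[>] 0) (𝓝 (((Finset.univ.filter fun i => IsActive M K i).card : ℝ) *
        (1 - 0))) :=
    ((continuous_const.mul (continuous_const.sub continuous_id)).tendsto 0).mono_left
      nhdsWithin_le_nhds
  rw [sub_zero, mul_one] at h2
  refine le_trans ?_ (le_of_tendsto h2 ?_)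
  · push_cast at h1
    linarith
  · filter_upwards [Ioc_mem_nhdsGT one_pos] with ε hε
    exact (isGreatest_totalDoF μ f hμ hM K).2
      (mul_card_isActive_mem_sumDoFs μ f hμ hM K hε.1 hε.2)

theorem tendsto_totalDoF_div (μ : Measure ℂ) [IsProbabilityMeasure μ] [NullSingletonClass μ]
    (f : Fading) (hμ : f = .timeVarying → Integrable (fun h : ℂ => Real.posLog ‖h‖) μ)
    {M : ℕ} (hM : 1 ≤ M) :
    Tendsto (fun K : ℕ => totalDoF μ f 1 M K / K) atTop (𝓝 (2 * M / (2 * M + 1))) := by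
  have hM0 : (0 : ℝ) < 2 * M + 1 := by positivity
  have hlo : Tendsto (fun K : ℕ => (2 * M / (2 * M + 1) : ℝ) - (2 * M) ^ 2 / (K : ℝ)) atTop
      (𝓝 ((2 * M / (2 * M + 1) : ℝ) - 0)) :=
    tendsto_const_nhds.sub (tendsto_natCast_atTop_atTop.const_div_atTop _)
  have hhi : Tendsto (fun K : ℕ => (2 * M / (2 * M + 1) : ℝ) + (2 * M) / (K : ℝ)) atTop
      (𝓝 ((2 * M / (2 * M + 1) : ℝ) + 0)) :=
    tendsto_const_nhds.add (tendsto_natCast_atTop_atTop.const_div_atTop _)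
  rw [sub_zero] at hlo
  rw [add_zero] at hhi
  have hfloor : ∀ K : ℕ, (K : ℝ) / (2 * M + 1) - 2 * M / (2 * M + 1) ≤
      ((K / (2 * M + 1) : ℕ) : ℝ) := by
    intro K
    have h1 := Nat.div_add_mod K (2 * M + 1)
    have h2 : K % (2 * M + 1) ≤ 2 * M := Nat.le_of_lt_succ (Nat.mod_lt _ (by omega))
    have h3 : K ≤ (2 * M + 1) * (K / (2 * M + 1)) + 2 * M := by omega
    have h4 : (K : ℝ) ≤ (2 * M + 1) * ((K / (2 * M + 1) : ℕ) : ℝ) + 2 * M := by exact_mod_cast h3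
    rw [← sub_div, div_le_iff₀ hM0]
    linarith
  have hfrac : (2 * M / (2 * M + 1) : ℝ) ≤ 1 := (div_le_one hM0).2 (by linarith)
  refine tendsto_of_tendsto_of_tendsto_of_le_of_le' hlo hhi ?_ ?_
  · filter_upwards [eventually_gt_atTop 0] with K hK
    have hK0 : (0 : ℝ) < K := by exact_mod_cast hK
    have h1 := le_totalDoF μ f hμ hM K
    have h2 := mul_le_mul_of_nonneg_left (hfloor K) (show (0 : ℝ) ≤ 2 * M by positivity)
    rw [le_div_iff₀ hK0, sub_mul, div_mul_cancel₀ _ hK0.ne']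
    have h3 : (2 * M : ℝ) * (2 * M / (2 * M + 1)) ≤ (2 * M) ^ 2 := by
      rw [pow_two]
      exact mul_le_mul_of_nonneg_left
        (div_le_self (by positivity) (by linarith [M.cast_nonneg (α := ℝ)])) (by positivity)
    have h4 : (2 * M / (2 * M + 1) : ℝ) * K = 2 * M * (K / (2 * M + 1)) := by ring
    linarith
  · filter_upwards [eventually_gt_atTop 0] with K hK
    have hK0 : (0 : ℝ) < K := by exact_mod_cast hK
    have h1 := totalDoF_le μ f hμ hM K
    have h2 := hfloor K
    rw [div_le_iff₀ hK0, add_mul, div_mul_cancel₀ _ hK0.ne']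
    have h3 : (2 * M / (2 * M + 1) : ℝ) ≤ 2 * M :=
      div_le_self (by positivity) (by linarith [M.cast_nonneg (α := ℝ)])
    have h4 : (2 * M / (2 * M + 1) : ℝ) * K = K - K / (2 * M + 1) := by
      field_simp
      ring
    linarith

end CoMP


theorem mainTheorem1 (M : ℕ) (hM : 1 ≤ M)
    (μ : Measure ℂ) [IsProbabilityMeasure μ] [NullSingletonClass μ] (f : CoMP.Fading)
    (hμ : f = CoMP.Fading.timeVarying → Integrable (fun h : ℂ => Real.posLog ‖h‖) μ) :
    (∀ K : ℕ, IsGreatest (CoMP.sumDoFs μ f 1 M K) (CoMP.totalDoF μ f 1 M K)) ∧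
      Tendsto (fun K : ℕ => CoMP.totalDoF μ f 1 M K / K) atTop
        (𝓝 (2 * M / (2 * M + 1))) :=
  ⟨CoMP.isGreatest_totalDoF μ f hμ hM, CoMP.tendsto_totalDoF_div μ f hμ hM⟩
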